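/- **Theorem.** All manifolds, tensor fields and maps are smooth, manifolds are finite-dimensional without boundary, and a *metric* is a smooth field of nondegenerate symmetric bilinear forms on the tangent spaces, with Levi-Civita connection $\nabla$. *Definitions.* An *almost golden structure* on $M$ is a $(1,1)$-tensor field $G$ with $G^2=G+I$; put $\widehat G=I-G$ and $P_G=\frac1{\sqrt5}(2G-I)$. Let $h$ be a metric on $M$. - $(M,h,G)$ is *almost golden-Hermitian* if $h(GX,Y)=h(X,\widehat GY)$ for all $X,Y$, and *almost golden Riemannian* if $h$ is positive definite and $h(GX,Y)=h(X,GY)$ for all $X,Y$. - An almost golden-Hermitian manifold is *semi golden-Kaehler* if $\operatorname{div}G=\sum_{i,j}h^{ij}(\nabla_{e_i}G)e_j=0$, where $(e_i)$ is a local frame of $TM$ and $(h^{ij})$ is the inverse of the matrix $(h(e_i,e_j))$ (for an orthonormal frame, $\operatorname{div}G=\sum_i h(e_i,e_i)(\nabla_{e_i}G)e_i$). - An almost golden-Hermitian manifold is *quasi golden-Kaehler* if $S_{\mathcal R}=0$ for $\mathcal R=P_G$, where $S_\varphi(X,Y)=(\nabla_X\varphi)Y+\varphi\big((\nabla_{\varphi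 X}\varphi)Y\big)$. - An almost golden Riemannian manifold is *locally decomposable* if $G$ is integrable, i.e. $G^2[X,Y]+[GX,GY]-G[GX,Y]-G[X,GY]=0$ for all vector fields $X,Y$, and $(\Psi_Gh)(X,Y,Z)=(\Psi_Gh)(Y,X,Z)+(\Psi_Gh)(GY,GX,Z)$ for all vector fields $X,Y,Z$. Here $(\Psi_Gh)(X,Y,Z)=(\phi_Gh)(X,Y,Z)+(\phi_Gh)(Z,Y,X)$ and $$(\phi_Gh)(X,Y,Z)=(GX)(h(Y,Z))-X(h(GY,Z))+h((\mathcal L_YG)X,Z)+h(Y,(\mathcal L_ZG)X).$$ - A smooth map $F:(M,G)\to(N,K)$ between manifolds with almost golden structures is *$\pm(G,K)$-golden* if either $F_*\circ G=K\circ F_*$ on all of $M$, or $F_*\circ G=\widehat K\circ F_*$ on all of $M$. - A smooth map $F:(M,h)\to(N,g)$ is *harmonic* if its tension field $\sum_{i,j}h^{ij}(\nabla F_*)(e_i,e_j)$ vanishes, where $(\nabla F_*)(X,Y)=\nabla^N_{F_*X}(F_*Y)-F_*(\nabla^M_XY)$ is the second fundamental form of $F$. *Statement.* Let $F:(M,h,G)\to(N,g,K)$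 be a $\pm(G,K)$-golden map from an almost golden-Hermitian manifold into an almost golden-Hermitian or almost golden Riemannian manifold. If either 1. $(M,h,G)$ is semi golden-Kaehler and $(N,g,K)$ is quasi golden-Kaehler, or 2. $(M,h,G)$ is semi golden-Kaehler and $(N,g,K)$ is a locally decomposable golden Riemannian manifold, then $F$ is harmonic. -/

import Mathlib

open scoped Manifold ContDiff

noncomputable section

/-! ## Local formulas in an open piece of the model space `E` -/

namespace GoldenGeometry

section Local

variable {E : Type*} [NormedAddCommGroup E] [NormedSpace ℝ E]
  {E' : Type*} [NormedAddCommGroup E'] [NormedSpace ℝ E']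

/-- The Christoffel symbols `Γ_y(u, v)` of a field `H` of symmetric nondegenerate bilinear forms:
`H_y(Γ_y(u, v), w) = (1/2) (∂_u H(v, w) + ∂_v H(u, w) - ∂_w H(u, v))` for all `w`.
Since `H_y`, seen as a linear map from `E` to its dual, is invertible when `H_y` is nondegenerate
and `E` is finite-dimensional, this is written with the inverse of that linear map. -/
def christoffel (H : E → E →L[ℝ] E →L[ℝ] ℝ) (y u v : E) : E :=
  (H y).inverse ((1 / 2 : ℝ) •
    (fderiv ℝ H y u v + fderiv ℝ H y v u - ((fderiv ℝ H y).flip u).flip v))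

/-- The covariant derivative `(∇_u A) v = ∇_u (A v) - A (∇_u v)` of a field `A` of endomorphisms,
for the Levi-Civita connection `∇_u V = ∂_u V + Γ(u, V)` of `H`. -/
def localNablaEnd (H : E → E →L[ℝ] E →L[ℝ] ℝ) (A : E → E →L[ℝ] E) (y u v : E) : E :=
  fderiv ℝ A y u v + christoffel H y u (A y v) - A y (christoffel H y u v)

/-- The second fundamental form of a map `f` from `(E, H)` to `(E', H')`: in coordinates,
`∂_i ∂_j f^c - Γ^k_ij ∂_k f^c + Γ'^c_ab ∂_i f^a ∂_j f^b`. -/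
def localSecondFundamentalForm (H : E → E →L[ℝ] E →L[ℝ] ℝ) (H' : E' → E' →L[ℝ] E' →L[ℝ] ℝ)
    (f : E → E') (y u v : E) : E' :=
  fderiv ℝ (fderiv ℝ f) y u v - fderiv ℝ f y (christoffel H y u v)
    + christoffel H' (f y) (fderiv ℝ f y u) (fderiv ℝ f y v)

end Local

/-! ## Metrics and (1,1)-tensor fields on a manifold -/

section Structures

variable (E : Type*) [NormedAddCommGroup E] [NormedSpace ℝ E]
  (M : Type*) [TopologicalSpace M] [ChartedSpace E M] [IsManifold 𝓘(ℝ, E) ∞ M]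

/-- A smooth (semi-Riemannian) metric on `M`: a smooth field of nondegenerate symmetric bilinear
forms on the tangent spaces. -/
structure Metric where
  /-- The bilinear form on each tangent space. -/
  val (x : M) : TangentSpace 𝓘(ℝ, E) x →L[ℝ] TangentSpace 𝓘(ℝ, E) x →L[ℝ] ℝ
  symm (x : M) (v w : TangentSpace 𝓘(ℝ, E) x) : val x v w = val x w v
  nondegenerate (x : M) (v : TangentSpace 𝓘(ℝ, E) x) : (∀ w, val x v w = 0) → v = 0
  contMDiff : ContMDiff 𝓘(ℝ, E) (𝓘(ℝ, E).prod 𝓘(ℝ, E →L[ℝ] E →L[ℝ] ℝ)) ∞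
    (fun x ↦ Bundle.TotalSpace.mk' (E →L[ℝ] E →L[ℝ] ℝ)
      (E := fun x ↦ TangentSpace 𝓘(ℝ, E) x →L[ℝ] TangentSpace 𝓘(ℝ, E) x →L[ℝ] ℝ) x (val x))

/-- A smooth (1,1)-tensor field on `M`. -/
structure EndField where
  /-- The endomorphism of each tangent space. -/
  val (x : M) : TangentSpace 𝓘(ℝ, E) x →L[ℝ] TangentSpace 𝓘(ℝ, E) x
  contMDiff : ContMDiff 𝓘(ℝ, E) (𝓘(ℝ, E).prod 𝓘(ℝ, E →L[ℝ] E)) ∞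
    (fun x ↦ Bundle.TotalSpace.mk' (E →L[ℝ] E)
      (E := fun x ↦ TangentSpace 𝓘(ℝ, E) x →L[ℝ] TangentSpace 𝓘(ℝ, E) x) x (val x))

end Structures

section Manifold

variable {E : Type*} [NormedAddCommGroup E] [NormedSpace ℝ E] [FiniteDimensional ℝ E]
  {M : Type*} [TopologicalSpace M] [ChartedSpace E M] [IsManifold 𝓘(ℝ, E) ∞ M]
  {E' : Type*} [NormedAddCommGroup E'] [NormedSpace ℝ E'] [FiniteDimensional ℝ E']
  {N : Type*} [TopologicalSpace N] [ChartedSpace E' N] [IsManifold 𝓘(ℝ, E') ∞ N]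

/-- The metric is Riemannian, i.e. positive definite. -/
def Metric.IsRiemannian (h : Metric E M) : Prop :=
  ∀ (x : M) (v : TangentSpace 𝓘(ℝ, E) x), v ≠ 0 → 0 < h.val x v v

/-! ## Levi-Civita connection, divergence, tension field -/

/-- The expression of the metric in the preferred chart at `x`: the pullback of the metric under
the inverse of the chart. -/
def Metric.inChart (h : Metric E M) (x : M) (y : E) : E →L[ℝ] E →L[ℝ] ℝ :=
  let p : M := (extChartAt 𝓘(ℝ, E) x).symm y
  let b : E →L[ℝ] E →L[ℝ] ℝ := h.val p
  let d : E →L[ℝ] E := mfderiv 𝓘(ℝ, E) 𝓘(ℝ, E) (extChartAt 𝓘(ℝ, E) x).symm y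
  b.bilinearComp d d

/-- The expression of a (1,1)-tensor field in the preferred chart at `x`: its conjugate by the
differential of the chart. -/
def endInChart (A : (x : M) → TangentSpace 𝓘(ℝ, E) x →L[ℝ] TangentSpace 𝓘(ℝ, E) x)
    (x : M) (y : E) : E →L[ℝ] E :=
  let p : M := (extChartAt 𝓘(ℝ, E) x).symm y
  let a : E →L[ℝ] E := A p
  let d : E →L[ℝ] E := mfderiv 𝓘(ℝ, E) 𝓘(ℝ, E) (extChartAt 𝓘(ℝ, E) x).symm y
  let d' : E →L[ℝ] E := mfderiv 𝓘(ℝ, E) 𝓘(ℝ, E) (extChartAt 𝓘(ℝ, E) x) p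
  d' ∘L a ∘L d

/-- `(∇_u A) v` at the point `x`, for the Levi-Civita connection `∇` of `h`. It is computed in the
preferred chart at `x`, whose differential at `x` is the identification of `T_x M` with `E`;
the result does not depend on the chart. -/
def nablaEnd (h : Metric E M)
    (A : (x : M) → TangentSpace 𝓘(ℝ, E) x →L[ℝ] TangentSpace 𝓘(ℝ, E) x)
    (x : M) (u v : TangentSpace 𝓘(ℝ, E) x) : TangentSpace 𝓘(ℝ, E) x :=
  localNablaEnd (E := E) (h.inChart x) (endInChart A x) (extChartAt 𝓘(ℝ, E) x x) u v

/-- The second fundamental form `(∇F_*)(u, v)` at the point `x` of a map `F` from `(M, h)` to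
`(N, g)`, computed in the preferred charts at `x` and at `F x`. -/
def secondFundamentalForm (h : Metric E M) (g : Metric E' N) (F : M → N) (x : M)
    (u v : TangentSpace 𝓘(ℝ, E) x) : TangentSpace 𝓘(ℝ, E') (F x) :=
  localSecondFundamentalForm (E := E) (E' := E') (h.inChart x) (g.inChart (F x))
    (writtenInExtChartAt 𝓘(ℝ, E) 𝓘(ℝ, E') x F) (extChartAt 𝓘(ℝ, E) x x) u v

/-- The metric trace `∑_{i,j} h^{ij} B(e_i, e_j)` at `x` of a bilinear map `B` on `T_x M`, where
`(h^{ij})` is the inverse of the matrix `(h(e_i, e_j))`. It does not depend on the basis `(e_i)`;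
for an orthonormal basis it is `∑_i h(e_i, e_i) B(e_i, e_i)`. -/
def metricTrace (h : Metric E M) (x : M) {W : Type*} [AddCommGroup W] [Module ℝ W]
    (B : TangentSpace 𝓘(ℝ, E) x → TangentSpace 𝓘(ℝ, E) x → W) : W :=
  let e : Module.Basis (Fin (Module.finrank ℝ E)) ℝ (TangentSpace 𝓘(ℝ, E) x) :=
    Module.finBasis ℝ E
  let gram : Matrix (Fin (Module.finrank ℝ E)) (Fin (Module.finrank ℝ E)) ℝ :=
    Matrix.of fun i j ↦ h.val x (e i) (e j)
  ∑ i, ∑ j, gram⁻¹ i j • B (e i) (e j)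

/-- The divergence of a (1,1)-tensor field: the metric trace of `(u, v) ↦ (∇_u A) v`. -/
def divergence (h : Metric E M)
    (A : (x : M) → TangentSpace 𝓘(ℝ, E) x →L[ℝ] TangentSpace 𝓘(ℝ, E) x) (x : M) :
    TangentSpace 𝓘(ℝ, E) x :=
  metricTrace h x (nablaEnd h A x)

/-- The tension field of a map: the metric trace of its second fundamental form. -/
def tensionField (h : Metric E M) (g : Metric E' N) (F : M → N) (x : M) :
    TangentSpace 𝓘(ℝ, E') (F x) :=
  metricTrace h x (secondFundamentalForm h g F x)

/-- A map is harmonic if it is smooth and its tension field vanishes. -/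
def IsHarmonic (h : Metric E M) (g : Metric E' N) (F : M → N) : Prop :=
  ContMDiff 𝓘(ℝ, E) 𝓘(ℝ, E') ∞ F ∧ ∀ x, tensionField h g F x = 0

/-! ## The Nijenhuis tensor and the operators `φ` and `Ψ` -/

/-- The Nijenhuis expression
`A² [X, Y] + [A X, A Y] - A [A X, Y] - A [X, A Y]` at the point `x`. -/
def nijenhuis (A : (x : M) → TangentSpace 𝓘(ℝ, E) x →L[ℝ] TangentSpace 𝓘(ℝ, E) x)
    (X Y : (x : M) → TangentSpace 𝓘(ℝ, E) x) (x : M) : TangentSpace 𝓘(ℝ, E) x :=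
  A x (A x (VectorField.mlieBracket 𝓘(ℝ, E) X Y x))
    + VectorField.mlieBracket 𝓘(ℝ, E) (fun p ↦ A p (X p)) (fun p ↦ A p (Y p)) x
    - A x (VectorField.mlieBracket 𝓘(ℝ, E) (fun p ↦ A p (X p)) Y x)
    - A x (VectorField.mlieBracket 𝓘(ℝ, E) X (fun p ↦ A p (Y p)) x)

/-- The vector field `X` is smooth near the point `x`. -/
def SmoothNear (X : (x : M) → TangentSpace 𝓘(ℝ, E) x) (x : M) : Prop :=
  ContMDiffAt 𝓘(ℝ, E) 𝓘(ℝ, E).tangent ∞ (fun p ↦ (⟨p, X p⟩ : TangentBundle 𝓘(ℝ, E) M)) x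

/-- `A` is integrable: its Nijenhuis tensor vanishes, on all local smooth vector fields. -/
def IsIntegrable (A : (x : M) → TangentSpace 𝓘(ℝ, E) x →L[ℝ] TangentSpace 𝓘(ℝ, E) x) : Prop :=
  ∀ (x : M) (X Y : (x : M) → TangentSpace 𝓘(ℝ, E) x),
    SmoothNear X x → SmoothNear Y x → nijenhuis A X Y x = 0

/-- The Lie derivative `(L_Y A) X = [Y, A X] - A [Y, X]` at the point `x`. -/
def lieDerivEnd (A : (x : M) → TangentSpace 𝓘(ℝ, E) x →L[ℝ] TangentSpace 𝓘(ℝ, E) x)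
    (Y X : (x : M) → TangentSpace 𝓘(ℝ, E) x) (x : M) : TangentSpace 𝓘(ℝ, E) x :=
  VectorField.mlieBracket 𝓘(ℝ, E) Y (fun p ↦ A p (X p)) x
    - A x (VectorField.mlieBracket 𝓘(ℝ, E) Y X x)

/-- The Tachibana operator, applied to the metric:
`(φ_A h)(X, Y, Z) = (A X)(h(Y, Z)) - X(h(A Y, Z)) + h((L_Y A) X, Z) + h(Y, (L_Z A) X)`. -/
def tachibana (h : Metric E M)
    (A : (x : M) → TangentSpace 𝓘(ℝ, E) x →L[ℝ] TangentSpace 𝓘(ℝ, E) x)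
    (X Y Z : (x : M) → TangentSpace 𝓘(ℝ, E) x) (x : M) : ℝ :=
  mvfderiv 𝓘(ℝ, E) (fun p ↦ h.val p (Y p) (Z p)) x (A x (X x))
    - mvfderiv 𝓘(ℝ, E) (fun p ↦ h.val p (A p (Y p)) (Z p)) x (X x)
    + h.val x (lieDerivEnd A Y X x) (Z x) + h.val x (Y x) (lieDerivEnd A Z X x)

/-- `(Ψ_A h)(X, Y, Z) = (φ_A h)(X, Y, Z) + (φ_A h)(Z, Y, X)`. -/
def psi (h : Metric E M)
    (A : (x : M) → TangentSpace 𝓘(ℝ, E) x →L[ℝ] TangentSpace 𝓘(ℝ, E) x)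
    (X Y Z : (x : M) → TangentSpace 𝓘(ℝ, E) x) (x : M) : ℝ :=
  tachibana h A X Y Z x + tachibana h A Z Y X x

/-- The condition `A(∗)`: `(Ψ_A h)(X, Y, Z) = (Ψ_A h)(Y, X, Z) + (Ψ_A h)(A Y, A X, Z)` for all
local smooth vector fields. -/
def StarCondition (h : Metric E M)
    (A : (x : M) → TangentSpace 𝓘(ℝ, E) x →L[ℝ] TangentSpace 𝓘(ℝ, E) x) : Prop :=
  ∀ (x : M) (X Y Z : (x : M) → TangentSpace 𝓘(ℝ, E) x),
    SmoothNear X x → SmoothNear Y x → SmoothNear Z x →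
    psi h A X Y Z x = psi h A Y X Z x + psi h A (fun p ↦ A p (Y p)) (fun p ↦ A p (X p)) Z x

/-! ## Golden structures -/

/-- `G` is an almost golden structure: `G² = G + I`. -/
def IsAlmostGolden (G : EndField E M) : Prop :=
  ∀ (x : M) (v : TangentSpace 𝓘(ℝ, E) x), G.val x (G.val x v) = G.val x v + v

/-- The almost product structure `(1 / √5) (2 G - I)` associated with `G`. -/
def twinProduct (G : EndField E M) (x : M) :
    TangentSpace 𝓘(ℝ, E) x →L[ℝ] TangentSpace 𝓘(ℝ, E) x :=
  (1 / √5 : ℝ) • ((2 : ℝ) • G.val x - ContinuousLinearMap.id ℝ (TangentSpace 𝓘(ℝ, E) x))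

/-- `S_A(u, v) = (∇_u A) v + A ((∇_{A u} A) v)`. -/
def sOperator (h : Metric E M)
    (A : (x : M) → TangentSpace 𝓘(ℝ, E) x →L[ℝ] TangentSpace 𝓘(ℝ, E) x)
    (x : M) (u v : TangentSpace 𝓘(ℝ, E) x) : TangentSpace 𝓘(ℝ, E) x :=
  nablaEnd h A x u v + A x (nablaEnd h A x (A x u) v)

/-- `(M, h, G)` is an almost golden-Hermitian manifold: the metric is hyperbolic with respect
to `G`, i.e. `h(G u, v) = h(u, Ĝ v)` with the conjugate structure `Ĝ = I - G`. -/
def IsAlmostGoldenHermitian (h : Metric E M) (G : EndField E M) : Prop :=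
  IsAlmostGolden G ∧
    ∀ (x : M) (u v : TangentSpace 𝓘(ℝ, E) x), h.val x (G.val x u) v = h.val x u (v - G.val x v)

/-- `(M, h, G)` is an almost golden Riemannian manifold: the metric is Riemannian and pure with
respect to `G`, i.e. `h(G u, v) = h(u, G v)`. -/
def IsAlmostGoldenRiemannian (h : Metric E M) (G : EndField E M) : Prop :=
  IsAlmostGolden G ∧ h.IsRiemannian ∧
    ∀ (x : M) (u v : TangentSpace 𝓘(ℝ, E) x), h.val x (G.val x u) v = h.val x u (G.val x v)

/-- Semi golden-Kaehler: almost golden-Hermitian with `div G = 0`. -/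
def IsSemiGoldenKaehler (h : Metric E M) (G : EndField E M) : Prop :=
  IsAlmostGoldenHermitian h G ∧ ∀ x, divergence h G.val x = 0

/-- Quasi golden-Kaehler: almost golden-Hermitian with `S_R = 0` for the associated product
structure `R` of `G`. -/
def IsQuasiGoldenKaehler (h : Metric E M) (G : EndField E M) : Prop :=
  IsAlmostGoldenHermitian h G ∧ ∀ x u v, sOperator h (twinProduct G) x u v = 0

/-- Locally decomposable golden Riemannian: almost golden Riemannian with `G` integrable and
satisfying the condition `G(∗)`. -/
def IsLocallyDecomposableGoldenRiemannian (h : Metric E M) (G : EndField E M) : Prop :=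
  IsAlmostGoldenRiemannian h G ∧ IsIntegrable G.val ∧ StarCondition h G.val

/-- `F` is a smooth `(G, K)`-golden map: `F_* ∘ G = K ∘ F_*`. -/
def IsGoldenMap (G : EndField E M) (K : EndField E' N) (F : M → N) : Prop :=
  ContMDiff 𝓘(ℝ, E) 𝓘(ℝ, E') ∞ F ∧
    ∀ (x : M) (v : TangentSpace 𝓘(ℝ, E) x),
      mfderiv 𝓘(ℝ, E) 𝓘(ℝ, E') F x (G.val x v) = K.val (F x) (mfderiv 𝓘(ℝ, E) 𝓘(ℝ, E') F x v)

/-- `F` is a smooth `(G, K)`-antigolden map: `F_* ∘ G = (I - K) ∘ F_*`. -/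
def IsAntigoldenMap (G : EndField E M) (K : EndField E' N) (F : M → N) : Prop :=
  ContMDiff 𝓘(ℝ, E) 𝓘(ℝ, E') ∞ F ∧
    ∀ (x : M) (v : TangentSpace 𝓘(ℝ, E) x),
      mfderiv 𝓘(ℝ, E) 𝓘(ℝ, E') F x (G.val x v) =
        mfderiv 𝓘(ℝ, E) 𝓘(ℝ, E') F x v - K.val (F x) (mfderiv 𝓘(ℝ, E) 𝓘(ℝ, E') F x v)

end Manifold

end GoldenGeometry

end

/-! Golden structures are handled through the product structures `P = (2G - I)/√5` and `R = (2K -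
I)/√5`, which satisfy `P² = I`, `R² = I`. Hyperbolicity of `h` makes `P` skew-adjoint, and `∇P =
(2/√5)∇G`, so `div G = 0` becomes `div P = 0`. The map intertwines `P` with `Q = R` (golden) or `Q =
-R` (antigolden).

Let `b = ∇F_*`, `c = ∇P`, and let `s` be the pullback of `∇Q` along `F_*`. Differentiating `F_* P =
Q F_*` gives `b(u, Pv) + F_* c(u, v) = s(u, v) + Q b(u, v)`. Applying this twice and using the
symmetry of `b`, `b(Pu, Pv) = b(u, v) + s(Pu, v) + Q s(v, u) - F_* c(Pu, v) - Q F_* c(v, u)`. Now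
take metric traces. Skew-adjointness and `P² = I` turn the left side into `-tr b`. The `c` terms
vanish because `div P = 0` and `∇P` anticommutes with `P`. The `s` terms cancel because `S_Q = 0`.
Hence `2 tr b = 0`. This is `sum_gram_inv_eq_zero`, applied in charts by `tensionField_eq_zero`.

In the locally decomposable case `S_R = 0` because `∇K = 0`. For a pure metric `Ψ(X, Y, Z) = 2
g((∇_Y K)X, Z)` (`psi_eq`), so the star condition is a linear relation on `∇K`, and `K² = K + I`
leaves it only the zero solution (`star_eq_zero`). -/

noncomputable section

namespace GoldenGeometry

open Filter Topology VectorField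

/-! ### Christoffel symbols, covariant derivatives and second fundamental forms in coordinates. -/

section LocalCalculus

variable {E : Type*} [NormedAddCommGroup E] [NormedSpace ℝ E]
  {E' : Type*} [NormedAddCommGroup E'] [NormedSpace ℝ E']

lemma fderiv_bilin_apply {H : E → E →L[ℝ] E →L[ℝ] ℝ} {V W : E → E} {y : E}
    (hH : DifferentiableAt ℝ H y) (hV : DifferentiableAt ℝ V y) (hW : DifferentiableAt ℝ W y)
    (u : E) :
    fderiv ℝ (fun z ↦ H z (V z) (W z)) y u =
      fderiv ℝ H y u (V y) (W y) + H y (fderiv ℝ V y u) (W y) + H y (V y) (fderiv ℝ W y u) := by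
  rw [fderiv_clm_apply (hH.clm_apply hV) hW, fderiv_clm_apply hH hV]
  simp
  ring

lemma fderiv_end_apply {A : E → E →L[ℝ] E'} {V : E → E} {y : E}
    (hA : DifferentiableAt ℝ A y) (hV : DifferentiableAt ℝ V y) (u : E) :
    fderiv ℝ (fun z ↦ A z (V z)) y u = fderiv ℝ A y u (V y) + A y (fderiv ℝ V y u) := by
  rw [fderiv_clm_apply hA hV]
  simp [add_comm]

lemma fderiv_bilin_symm {H : E → E →L[ℝ] E →L[ℝ] ℝ} {y : E} (hH : DifferentiableAt ℝ H y)
    (hs : ∀ᶠ z in 𝓝 y, ∀ u v, H z u v = H z v u) (w u v : E) :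
    fderiv ℝ H y w u v = fderiv ℝ H y w v u := by
  have h := fderiv_bilin_apply hH (differentiableAt_const u) (differentiableAt_const v) w
  have h' := fderiv_bilin_apply hH (differentiableAt_const v) (differentiableAt_const u) w
  have e : (fun z ↦ H z u v) =ᶠ[𝓝 y] fun z ↦ H z v u := hs.mono fun z hz ↦ hz u v
  rw [e.fderiv_eq, h'] at h
  simpa using h.symm

lemma christoffel_symm {H : E → E →L[ℝ] E →L[ℝ] ℝ} {y : E} (hH : DifferentiableAt ℝ H y)
    (hs : ∀ᶠ z in 𝓝 y, ∀ u v, H z u v = H z v u) (u v : E) :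
    christoffel H y u v = christoffel H y v u := by
  unfold christoffel
  congr 2
  ext w
  simp [fderiv_bilin_symm hH hs w u v]
  ring

lemma christoffel_add_left (H : E → E →L[ℝ] E →L[ℝ] ℝ) (y u u' v : E) :
    christoffel H y (u + u') v = christoffel H y u v + christoffel H y u' v := by
  unfold christoffel
  rw [← map_add]
  congr 1
  ext w
  simp
  ring

lemma christoffel_add_right (H : E → E →L[ℝ] E →L[ℝ] ℝ) (y u v v' : E) :
    christoffel H y u (v + v') = christoffel H y u v + christoffel H y u v' := by
  unfold christoffel
  rw [← map_add]
  congr 1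
  ext w
  simp
  ring

lemma christoffel_smul_left (H : E → E →L[ℝ] E →L[ℝ] ℝ) (y : E) (c : ℝ) (u v : E) :
    christoffel H y (c • u) v = c • christoffel H y u v := by
  unfold christoffel
  rw [← map_smul]
  congr 1
  ext w
  simp
  ring

lemma christoffel_smul_right (H : E → E →L[ℝ] E →L[ℝ] ℝ) (y : E) (c : ℝ) (u v : E) :
    christoffel H y u (c • v) = c • christoffel H y u v := by
  unfold christoffel
  rw [← map_smul]
  congr 1
  ext w
  simp
  ring

/-- The covariant derivative of a field of endomorphisms, as a bilinear map. -/
def localNablaEndₗ (H : E → E →L[ℝ] E →L[ℝ] ℝ) (A : E → E →L[ℝ] E) (y : E) : E →ₗ[ℝ] E →ₗ[ℝ] E :=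
  LinearMap.mk₂ ℝ (localNablaEnd H A y)
    (fun u u' v ↦ by simp only [localNablaEnd, christoffel_add_left, map_add, add_apply]; abel)
    (fun c u v ↦ by
      simp only [localNablaEnd, christoffel_smul_left, map_smul, smul_apply, smul_add, smul_sub])
    (fun u v v' ↦ by simp only [localNablaEnd, christoffel_add_right, map_add]; abel)
    (fun c u v ↦ by
      simp only [localNablaEnd, christoffel_smul_right, map_smul, smul_add, smul_sub])

/-- The second fundamental form of a map, as a bilinear map. -/
def localSecondFundamentalFormₗ (H : E → E →L[ℝ] E →L[ℝ] ℝ) (H' : E' → E' →L[ℝ] E' →L[ℝ] ℝ)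
    (f : E → E') (y : E) : E →ₗ[ℝ] E →ₗ[ℝ] E' :=
  LinearMap.mk₂ ℝ (localSecondFundamentalForm H H' f y)
    (fun u u' v ↦ by
      simp only [localSecondFundamentalForm, christoffel_add_left, map_add, add_apply]; abel)
    (fun c u v ↦ by
      simp only [localSecondFundamentalForm, christoffel_smul_left, map_smul, smul_apply, smul_add,
        smul_sub])
    (fun u v v' ↦ by simp only [localSecondFundamentalForm, christoffel_add_right, map_add]; abel)
    (fun c u v ↦ by
      simp only [localSecondFundamentalForm, christoffel_smul_right, map_smul, smul_add, smul_sub])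

/-- Second derivatives commute and both connections are torsion-free. -/
lemma localSecondFundamentalForm_symm {H : E → E →L[ℝ] E →L[ℝ] ℝ}
    {H' : E' → E' →L[ℝ] E' →L[ℝ] ℝ} {f : E → E'} {y : E}
    (hH : DifferentiableAt ℝ H y) (hs : ∀ᶠ z in 𝓝 y, ∀ u v, H z u v = H z v u)
    (hH' : DifferentiableAt ℝ H' (f y)) (hs' : ∀ᶠ z in 𝓝 (f y), ∀ u v, H' z u v = H' z v u)
    (hf : ContDiffAt ℝ ∞ f y) (u v : E) :
    localSecondFundamentalForm H H' f y u v = localSecondFundamentalForm H H' f y v u := by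
  have h2 : IsSymmSndFDerivAt ℝ f y := by
    refine hf.isSymmSndFDerivAt ?_
    rw [minSmoothness_of_isRCLikeNormedField]
    exact ENat.LEInfty.out
  unfold localSecondFundamentalForm
  rw [h2.eq u v, christoffel_symm hH hs u v, christoffel_symm hH' hs']

/-- Differentiating `df ∘ A = B ∘ df`. -/
lemma localSecondFundamentalForm_intertwine {H : E → E →L[ℝ] E →L[ℝ] ℝ}
    {H' : E' → E' →L[ℝ] E' →L[ℝ] ℝ} {f : E → E'} {y : E}
    {A : E → E →L[ℝ] E} {B : E' → E' →L[ℝ] E'}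
    (hA : DifferentiableAt ℝ A y) (hB : DifferentiableAt ℝ B (f y)) (hf : ContDiffAt ℝ ∞ f y)
    (hc : ∀ᶠ z in 𝓝 y, ∀ v, fderiv ℝ f z (A z v) = B (f z) (fderiv ℝ f z v)) (u v : E) :
    localSecondFundamentalForm H H' f y u (A y v) + fderiv ℝ f y (localNablaEnd H A y u v) =
      localNablaEnd H' B (f y) (fderiv ℝ f y u) (fderiv ℝ f y v)
        + B (f y) (localSecondFundamentalForm H H' f y u v) := by
  have hf1 : DifferentiableAt ℝ f y := hf.differentiableAt (by simp)
  have hf2 : DifferentiableAt ℝ (fderiv ℝ f) y :=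
    (hf.fderiv_right (m := 1) (by rw [one_add_one_eq_two]; exact ENat.LEInfty.out)).differentiableAt (by simp)
  have hf3 : ∀ w, DifferentiableAt ℝ (fun z ↦ fderiv ℝ f z w) y := fun w ↦
    hf2.clm_apply (differentiableAt_const w)
  have hAv : DifferentiableAt ℝ (fun z ↦ A z v) y := hA.clm_apply (differentiableAt_const v)
  have hBf : DifferentiableAt ℝ (fun z ↦ B (f z)) y := hB.comp y hf1
  have e : (fun z ↦ fderiv ℝ f z (A z v)) =ᶠ[𝓝 y] fun z ↦ B (f z) (fderiv ℝ f z v) :=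
    hc.mono fun z hz ↦ hz v
  have key := DFunLike.congr_fun (e.fderiv_eq (𝕜 := ℝ)) u
  have l1 : fderiv ℝ (fun z ↦ fderiv ℝ f z (A z v)) y u
      = fderiv ℝ (fderiv ℝ f) y u (A y v) + fderiv ℝ f y (fderiv ℝ A y u v) := by
    rw [fderiv_end_apply hf2 hAv, fderiv_end_apply hA (differentiableAt_const v)]
    simp
  have l2 : fderiv ℝ (fun z ↦ B (f z) (fderiv ℝ f z v)) y u
      = fderiv ℝ B (f y) (fderiv ℝ f y u) (fderiv ℝ f y v)
        + B (f y) (fderiv ℝ (fderiv ℝ f) y u v) := by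
    rw [fderiv_clm_apply hBf (hf3 v), add_comm]
    have : fderiv ℝ (fun z ↦ B (f z)) y = (fderiv ℝ B (f y)).comp (fderiv ℝ f y) :=
      fderiv_comp y hB hf1
    have h2 := fderiv_end_apply hf2 (differentiableAt_const v) u
    simp only [fderiv_const_apply, zero_apply, map_zero, add_zero] at h2
    simp [this, h2]
  have key' := l1.symm.trans (key.trans l2)
  have c0 := hc.self_of_nhds
  -- `c0` makes the two target Christoffel terms with argument `df (A v) = B (df v)` agree; all
  -- other Christoffel terms cancel in pairs, leaving the differentiated identity `key'`.
  simp only [localSecondFundamentalForm, localNablaEnd, map_add, map_sub, c0]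
  rw [← sub_eq_zero] at key' ⊢
  rw [← key']
  abel

end LocalCalculus

/-! ### Levi-Civita identities and the Tachibana operator for a nondegenerate metric. -/

section LocalMetric

variable {E : Type*} [NormedAddCommGroup E] [NormedSpace ℝ E] [FiniteDimensional ℝ E]

/-- Guarantees that the `inverse` in `christoffel` is a genuine inverse and not its default value 0:
an injective map from `E` to its dual is bijective by dimension. -/
lemma isInvertible_of_nondegenerate {b : E →L[ℝ] E →L[ℝ] ℝ} (hb : ∀ v, (∀ w, b v w = 0) → v = 0) :
    b.IsInvertible := by
  have inj : Function.Injective b.toLinearMap := by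
    rw [injective_iff_map_eq_zero]
    intro v hv
    exact hb v fun w ↦ by simpa using congrArg (fun L : E →L[ℝ] ℝ ↦ L w) hv
  have fr : Module.finrank ℝ E = Module.finrank ℝ (E →L[ℝ] ℝ) := by
    rw [← (LinearMap.toContinuousLinearMap (𝕜 := ℝ) (E := E) (F' := ℝ)).finrank_eq]
    exact Subspace.dual_finrank_eq.symm
  refine ⟨(LinearEquiv.ofInjectiveOfFinrankEq b.toLinearMap inj fr).toContinuousLinearEquiv, ?_⟩
  ext v w
  rfl

lemma christoffel_spec {H : E → E →L[ℝ] E →L[ℝ] ℝ} {y : E}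
    (hb : ∀ v, (∀ w, H y v w = 0) → v = 0) (u v w : E) :
    H y (christoffel H y u v) w =
      1 / 2 * (fderiv ℝ H y u v w + fderiv ℝ H y v u w - fderiv ℝ H y w u v) := by
  unfold christoffel
  rw [(isInvertible_of_nondegenerate hb).self_apply_inverse]
  simp

/-- The Levi-Civita connection is metric. -/
lemma fderiv_metric_eq {H : E → E →L[ℝ] E →L[ℝ] ℝ} {y : E} (hH : DifferentiableAt ℝ H y)
    (hs : ∀ᶠ z in 𝓝 y, ∀ u v, H z u v = H z v u)
    (hb : ∀ v, (∀ w, H y v w = 0) → v = 0) (u v w : E) :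
    fderiv ℝ H y u v w = H y (christoffel H y u v) w + H y v (christoffel H y u w) := by
  rw [hs.self_of_nhds v, christoffel_spec hb, christoffel_spec hb,
    fderiv_bilin_symm hH hs w u v, fderiv_bilin_symm hH hs u w v, fderiv_bilin_symm hH hs v u w]
  ring

/-- The covariant derivative of a self-adjoint field of endomorphisms is self-adjoint. -/
lemma localNablaEnd_pure {H : E → E →L[ℝ] E →L[ℝ] ℝ} {A : E → E →L[ℝ] E} {y : E}
    (hH : DifferentiableAt ℝ H y) (hA : DifferentiableAt ℝ A y)
    (hs : ∀ᶠ z in 𝓝 y, ∀ u v, H z u v = H z v u)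
    (hb : ∀ v, (∀ w, H y v w = 0) → v = 0)
    (hp : ∀ᶠ z in 𝓝 y, ∀ u v, H z (A z u) v = H z u (A z v)) (u v w : E) :
    H y (localNablaEnd H A y u v) w = H y v (localNablaEnd H A y u w) := by
  have cA : ∀ v, DifferentiableAt ℝ (fun z ↦ A z v) y := fun v ↦
    hA.clm_apply (differentiableAt_const v)
  have dA : ∀ v, fderiv ℝ (fun z ↦ A z v) y u = fderiv ℝ A y u v := fun v ↦ by
    rw [fderiv_end_apply hA (differentiableAt_const v)]; simp
  have e : (fun z ↦ H z (A z v) w) =ᶠ[𝓝 y] fun z ↦ H z v (A z w) := hp.mono fun z hz ↦ hz v w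
  have key := DFunLike.congr_fun (e.fderiv_eq (𝕜 := ℝ)) u
  rw [fderiv_bilin_apply hH (cA v) (differentiableAt_const w),
    fderiv_bilin_apply hH (differentiableAt_const v) (cA w), dA, dA,
    fderiv_metric_eq hH hs hb, fderiv_metric_eq hH hs hb] at key
  have p := hp.self_of_nhds
  simp only [fderiv_fun_const, Pi.zero_apply, zero_apply, map_zero, p] at key
  simp only [localNablaEnd, map_add, map_sub, add_apply, sub_apply, p]
  linarith

/-- The Tachibana operator in a chart, on fields of vectors. -/
def localTachibana (H : E → E →L[ℝ] E →L[ℝ] ℝ) (A : E → E →L[ℝ] E) (X Y Z : E → E) (y : E) : ℝ :=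
  fderiv ℝ (fun z ↦ H z (Y z) (Z z)) y (A y (X y))
    - fderiv ℝ (fun z ↦ H z (A z (Y z)) (Z z)) y (X y)
    + H y (lieBracket ℝ Y (fun z ↦ A z (X z)) y - A y (lieBracket ℝ Y X y)) (Z y)
    + H y (Y y) (lieBracket ℝ Z (fun z ↦ A z (X z)) y - A y (lieBracket ℝ Z X y))

/-- Metric compatibility and vanishing torsion replace every derivative and bracket by covariant
ones; the derivatives of the vector fields then cancel by purity, so only `∇A` survives. -/
lemma localTachibana_eq {H : E → E →L[ℝ] E →L[ℝ] ℝ} {A : E → E →L[ℝ] E} {X Y Z : E → E} {y : E}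
    (hH : DifferentiableAt ℝ H y) (hA : DifferentiableAt ℝ A y)
    (hs : ∀ᶠ z in 𝓝 y, ∀ u v, H z u v = H z v u)
    (hb : ∀ v, (∀ w, H y v w = 0) → v = 0)
    (hp : ∀ᶠ z in 𝓝 y, ∀ u v, H z (A z u) v = H z u (A z v))
    (hX : DifferentiableAt ℝ X y) (hY : DifferentiableAt ℝ Y y) (hZ : DifferentiableAt ℝ Z y) :
    localTachibana H A X Y Z y =
      - H y (localNablaEnd H A y (X y) (Y y)) (Z y) + H y (localNablaEnd H A y (Y y) (X y)) (Z y)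
        + H y (localNablaEnd H A y (Z y) (X y)) (Y y) := by
  have s := hs.self_of_nhds
  have p := hp.self_of_nhds
  unfold localTachibana
  rw [fderiv_bilin_apply hH hY hZ, fderiv_bilin_apply hH (hA.clm_apply hY) hZ]
  simp only [lieBracket, fderiv_end_apply hA hX, fderiv_end_apply hA hY, map_sub, map_add,
    fderiv_metric_eq hH hs hb, sub_apply, add_apply, localNablaEnd]
  rw [s _ (Y y), s _ (Y y), s _ (Y y)]
  simp only [p, christoffel_symm hH hs (Y y) (X y), christoffel_symm hH hs (Z y) (X y),
    christoffel_symm hH hs _ (A y (X y))]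
  ring

end LocalMetric

/-! ### Linear algebra: the star relation and metric traces. -/

section LinearAlgebra

/-- On eigenvectors of `K` with eigenvalues `λ, μ` the relation reads `D v u = (1 + λμ) D u v`, so
`D u v = (1 + λμ)² D u v`. Since `λμ` is `-1` or the square of a root of `t² = t + 1`, the factor
`(1 + λμ)²` is never 1. The proof does the same by elimination, without diagonalising. -/
lemma star_eq_zero {E : Type*} [AddCommGroup E] [Module ℝ E] (D : E →ₗ[ℝ] E →ₗ[ℝ] E)
    (K : E →ₗ[ℝ] E) (hK : ∀ v, K (K v) = K v + v)
    (hD : ∀ u v, D v u = D u v + D (K u) (K v)) (u v : E) : D u v = 0 := by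
  have h1 := hD u v
  have h2 := hD (K u) v
  have h3 := hD u (K v)
  have h4 := hD (K u) (K v)
  have h5 := hD v u
  have h6 := hD (K v) u
  have h7 := hD v (K u)
  have h8 := hD (K v) (K u)
  simp only [hK, map_add, LinearMap.add_apply] at h2 h3 h4 h6 h7 h8
  generalize D u v = a at *
  generalize D (K u) v = b at *
  generalize D u (K v) = c at *
  generalize D (K u) (K v) = d at *
  generalize D v u = a' at *
  generalize D (K v) u = b' at *
  generalize D v (K u) = c' at *
  generalize D (K v) (K u) = d' at *
  have hd' : d' = - d := by linear_combination (norm := module) - h1 - h5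
  have hbc : c = b := by linear_combination (norm := module) h6 - h7
  have hd : d = -(3 : ℝ) • b := by
    rw [h2, h3, hd', hbc] at h6
    linear_combination (norm := module) - h6
  have ha : a = (7 : ℝ) • b := by
    rw [hd', hbc, hd] at h4
    linear_combination (norm := module) - h4
  have ha' : a = -(4 : ℝ) • b := by
    rw [h2, h3, hd', hbc, h1, hd] at h8
    linear_combination (norm := module) - h8
  -- The weights sum to 1 and eliminate `b` from `a = 7b` and `a = -4b`.
  linear_combination (norm := module) (4 / 11 : ℝ) • ha + (7 / 11 : ℝ) • ha'

/-- A left null vector of the Gram matrix gives the coordinates of a vector in the radical of `b`.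
Invertibility is needed because `⁻¹` of a singular matrix is 0. -/
lemma gram_det_isUnit {ι E : Type*} [Fintype ι] [DecidableEq ι] [AddCommGroup E] [Module ℝ E]
    (e : Module.Basis ι ℝ E) (b : E →ₗ[ℝ] E →ₗ[ℝ] ℝ) (hb : ∀ v, (∀ w, b v w = 0) → v = 0) :
    IsUnit (Matrix.of fun i j ↦ b (e i) (e j)).det := by
  rw [isUnit_iff_ne_zero]
  intro h0
  obtain ⟨v, hv, h⟩ := Matrix.exists_vecMul_eq_zero_iff.2 h0
  apply hv
  have : ∑ i, v i • e i = 0 := by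
    refine hb _ fun w ↦ ?_
    have : b (∑ i, v i • e i) = 0 := by
      refine e.ext fun j ↦ ?_
      simpa [Matrix.vecMul, dotProduct] using congrFun h j
    simp [this]
  exact funext (Fintype.linearIndependent_iff.1 e.linearIndependent v this)

/-- The metric trace satisfies `tr B(P·, ·) = - tr B(·, P·)` for `P` skew-adjoint. -/
lemma sum_gram_inv_skew {ι E W : Type*} [Fintype ι] [DecidableEq ι] [AddCommGroup E] [Module ℝ E]
    [AddCommGroup W] [Module ℝ W]
    (e : Module.Basis ι ℝ E) (b : E →ₗ[ℝ] E →ₗ[ℝ] ℝ) (hb : ∀ v, (∀ w, b v w = 0) → v = 0)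
    (P : E →ₗ[ℝ] E) (hP : ∀ u v, b (P u) v = - b u (P v)) (B : E →ₗ[ℝ] E →ₗ[ℝ] W) :
    ∑ i, ∑ j, (Matrix.of fun i j ↦ b (e i) (e j))⁻¹ i j • B (P (e i)) (e j) =
      - ∑ i, ∑ j, (Matrix.of fun i j ↦ b (e i) (e j))⁻¹ i j • B (e i) (P (e j)) := by
  set g : Matrix ι ι ℝ := Matrix.of fun i j ↦ b (e i) (e j) with hg
  have hu : IsUnit g.det := gram_det_isUnit e b hb
  set p : Matrix ι ι ℝ := LinearMap.toMatrix e e P with hp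
  have hPe : ∀ j, P (e j) = ∑ i, p i j • e i := fun j ↦ by
    rw [← e.sum_repr (P (e j))]
    simp [hp, LinearMap.toMatrix_apply]
  -- Skew-adjointness in matrix form; multiplying by `g⁻¹` on both sides transfers it to the inverse
  -- Gram matrix in `h2`.
  have h1 : p.transpose * g = - (g * p) := by
    ext i j
    have := hP (e i) (e j)
    rw [hPe, hPe] at this
    simp only [map_sum, LinearMap.sum_apply, map_smul, LinearMap.smul_apply, smul_eq_mul] at this
    simp only [Matrix.mul_apply, Matrix.transpose_apply, Matrix.neg_apply, hg, Matrix.of_apply]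
    rw [this]
    simp [mul_comm]
  have h2 : g⁻¹ * p.transpose = - (p * g⁻¹) := by
    have : g⁻¹ * (p.transpose * g) * g⁻¹ = g⁻¹ * (-(g * p)) * g⁻¹ := by rw [h1]
    rw [Matrix.mul_neg, ← Matrix.mul_assoc g⁻¹ g, Matrix.nonsing_inv_mul g hu, Matrix.one_mul,
      ← Matrix.mul_assoc, Matrix.mul_assoc _ g, Matrix.mul_nonsing_inv g hu, Matrix.mul_one,
      Matrix.neg_mul] at this
    exact this
  have l : ∑ i, ∑ j, g⁻¹ i j • B (P (e i)) (e j) = ∑ k, ∑ j, (p * g⁻¹) k j • B (e k) (e j) := by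
    simp only [hPe, map_sum, LinearMap.sum_apply, map_smul, LinearMap.smul_apply, Matrix.mul_apply,
      Finset.smul_sum, Finset.sum_smul, smul_smul]
    rw [Finset.sum_congr rfl fun i _ ↦ Finset.sum_comm, Finset.sum_comm]
    refine Finset.sum_congr rfl fun k _ ↦ ?_
    rw [Finset.sum_comm]
    exact Finset.sum_congr rfl fun j _ ↦ Finset.sum_congr rfl fun i _ ↦ by rw [mul_comm]
  have r : ∑ i, ∑ j, g⁻¹ i j • B (e i) (P (e j)) =
      ∑ i, ∑ k, (g⁻¹ * p.transpose) i k • B (e i) (e k) := by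
    simp only [hPe, map_sum, map_smul, Matrix.mul_apply, Finset.smul_sum, Finset.sum_smul,
      smul_smul, Matrix.transpose_apply]
    exact Finset.sum_congr rfl fun i _ ↦ Finset.sum_comm
  rw [l, r, h2]
  simp [Finset.sum_neg_distrib]

lemma sum_gram_inv_flip {ι E W : Type*} [Fintype ι] [DecidableEq ι] [AddCommGroup E] [Module ℝ E]
    [AddCommGroup W] [Module ℝ W]
    (e : Module.Basis ι ℝ E) (b : E →ₗ[ℝ] E →ₗ[ℝ] ℝ) (hs : ∀ u v, b u v = b v u)
    (B : E →ₗ[ℝ] E →ₗ[ℝ] W) :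
    ∑ i, ∑ j, (Matrix.of fun i j ↦ b (e i) (e j))⁻¹ i j • B (e j) (e i) =
      ∑ i, ∑ j, (Matrix.of fun i j ↦ b (e i) (e j))⁻¹ i j • B (e i) (e j) := by
  set g : Matrix ι ι ℝ := Matrix.of fun i j ↦ b (e i) (e j) with hg
  have : g⁻¹.transpose = g⁻¹ := by
    rw [Matrix.transpose_nonsing_inv]
    congr 1
    ext i j
    exact hs _ _
  rw [Finset.sum_comm]
  refine Finset.sum_congr rfl fun i _ ↦ Finset.sum_congr rfl fun j _ ↦ ?_
  rw [← congrFun (congrFun this i) j, Matrix.transpose_apply]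

/-- The linear algebra of harmonicity: `b` is the second fundamental form, `c` the covariant
derivative of the product structure `P` of the source, and `s` that of the target, pulled back. -/
lemma sum_gram_inv_eq_zero {ι E W : Type*} [Fintype ι] [DecidableEq ι] [AddCommGroup E]
    [Module ℝ E] [AddCommGroup W] [Module ℝ W]
    (e : Module.Basis ι ℝ E) (h : E →ₗ[ℝ] E →ₗ[ℝ] ℝ) (hs : ∀ u v, h u v = h v u)
    (hn : ∀ v, (∀ w, h v w = 0) → v = 0)
    (P : E →ₗ[ℝ] E) (hP : ∀ u v, h (P u) v = - h u (P v)) (hPP : ∀ v, P (P v) = v)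
    (Q : W →ₗ[ℝ] W) (hQQ : ∀ v, Q (Q v) = v) (L : E →ₗ[ℝ] W)
    (b : E →ₗ[ℝ] E →ₗ[ℝ] W) (c : E →ₗ[ℝ] E →ₗ[ℝ] E) (s : E →ₗ[ℝ] E →ₗ[ℝ] W)
    (hb : ∀ u v, b u v = b v u) (hc : ∀ u v, c u (P v) = - P (c u v))
    (hbc : ∀ u v, b u (P v) + L (c u v) = s u v + Q (b u v))
    (hS : ∀ u v, s u v + Q (s (P u) v) = 0)
    (htr : ∑ i, ∑ j, (Matrix.of fun i j ↦ h (e i) (e j))⁻¹ i j • c (e i) (e j) = 0) :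
    ∑ i, ∑ j, (Matrix.of fun i j ↦ h (e i) (e j))⁻¹ i j • b (e i) (e j) = 0 := by
  set g : Matrix ι ι ℝ := (Matrix.of fun i j ↦ h (e i) (e j))⁻¹ with hg
  let T : (E →ₗ[ℝ] E →ₗ[ℝ] W) →ₗ[ℝ] W :=
    { toFun B := ∑ i, ∑ j, g i j • B (e i) (e j)
      map_add' B B' := by simp [Finset.sum_add_distrib]
      map_smul' r B := by simp [Finset.smul_sum, smul_comm r] }
  have hflip : ∀ B, T B.flip = T B := fun B ↦ sum_gram_inv_flip e h hs B
  have hskew : ∀ B, T (B ∘ₗ P) = - T (B.compl₂ P) := fun B ↦ sum_gram_inv_skew e h hn P hP B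
  have hcomp : ∀ (R : E →ₗ[ℝ] W), T (c.compr₂ R) = 0 := fun R ↦ by
    have := congrArg R htr
    simpa [T, map_sum] using this
  -- the terms of `b (P u) (P v)`
  have t1 : T ((b ∘ₗ P).compl₂ P) = - T b := by
    have := hskew (b.compl₂ P)
    have e1 : (b.compl₂ P) ∘ₗ P = (b ∘ₗ P).compl₂ P := by ext; simp
    have e2 : (b.compl₂ P).compl₂ P = b := by ext; simp [hPP]
    rwa [e1, e2] at this
  have t2 : T ((c ∘ₗ P).compr₂ L) = 0 := by
    have := hskew (c.compr₂ L)
    have e1 : (c.compr₂ L) ∘ₗ P = (c ∘ₗ P).compr₂ L := by ext; simp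
    have e2 : (c.compr₂ L).compl₂ P = - c.compr₂ (L ∘ₗ P) := by ext; simp [hc]
    rwa [e1, e2, map_neg, hcomp, neg_zero, neg_zero] at this
  have t3 : T (c.flip.compr₂ (Q ∘ₗ L)) = 0 := by
    rw [← hcomp (Q ∘ₗ L), ← hflip (c.compr₂ (Q ∘ₗ L))]
    rfl
  -- Applying `Q` to `hS` gives `Q s(u, v) = -s(Pu, v)`, so the two `s` terms of `key` have opposite
  -- traces.
  have t4 : T (s.flip.compr₂ Q) = - T (s ∘ₗ P) := by
    have e1 : s.compr₂ Q = - (s ∘ₗ P) := by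
      refine LinearMap.ext₂ fun u v ↦ ?_
      have := congrArg Q (hS u v)
      simp only [map_add, hQQ, map_zero] at this
      simpa using eq_neg_of_add_eq_zero_left this
    rw [← map_neg, ← e1, ← hflip (s.compr₂ Q)]
    rfl
  -- `hbc` is used once for each `P`, with the arguments of `b` exchanged in between; `Q² = I`
  -- restores `b`.
  have key : (b ∘ₗ P).compl₂ P =
      s ∘ₗ P + s.flip.compr₂ Q + b - c.flip.compr₂ (Q ∘ₗ L) - (c ∘ₗ P).compr₂ L := by
    refine LinearMap.ext₂ fun u v ↦ ?_
    have h1 : b (P u) (P v) = s (P u) v + Q (b (P u) v) - L (c (P u) v) :=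
      eq_sub_of_add_eq (hbc (P u) v)
    have h2 : b v (P u) = s v u + Q (b v u) - L (c v u) := eq_sub_of_add_eq (hbc v u)
    rw [hb (P u) v, h2, map_sub, map_add, hQQ, hb v u] at h1
    simp only [LinearMap.compl₂_apply, LinearMap.comp_apply, LinearMap.sub_apply,
      LinearMap.add_apply, LinearMap.compr₂_apply, LinearMap.flip_apply, h1]
    abel
  have final := congrArg T key
  rw [map_sub, map_sub, map_add, map_add, t1, t2, t3, t4] at final
  have : (2 : ℝ) • T b = 0 := by
    rw [two_smul]
    nth_rewrite 1 [← neg_neg (T b), final]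
    abel
  exact (smul_eq_zero.1 this).resolve_left two_ne_zero

end LinearAlgebra

/-- In finite dimension `L` is a finite sum of its values on a basis tensored with the dual basis.
This reduces regularity of tensors in a chart to that of their components. -/
lemma differentiableAt_of_apply {D E F : Type*} [NormedAddCommGroup D] [NormedSpace ℝ D]
    [NormedAddCommGroup E] [NormedSpace ℝ E] [FiniteDimensional ℝ E]
    [NormedAddCommGroup F] [NormedSpace ℝ F] {L : D → E →L[ℝ] F} {y : D}
    (h : ∀ v, DifferentiableAt ℝ (fun z ↦ L z v) y) : DifferentiableAt ℝ L y := by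
  let e := Module.finBasis ℝ E
  let c : Fin (Module.finrank ℝ E) → E →L[ℝ] ℝ := fun i ↦ (e.coord i).toContinuousLinearMap
  have : L = fun z ↦ ∑ i, ContinuousLinearMap.smulRightL ℝ E F (c i) (L z (e i)) := by
    ext z v
    conv_lhs => rw [← e.sum_repr v, map_sum]
    simp [c, -Module.Basis.sum_repr]
  rw [this]
  exact DifferentiableAt.fun_sum fun i _ ↦
    (ContinuousLinearMap.differentiableAt _).comp y (h (e i))

/-! ### Vector fields and Lie brackets in the preferred chart. -/

section Charts

variable {E : Type*} [NormedAddCommGroup E] [NormedSpace ℝ E]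
  {M : Type*} [TopologicalSpace M] [ChartedSpace E M]

/-- The differential at `p` of the preferred chart at `x`. -/
def dChart (E : Type*) [NormedAddCommGroup E] [NormedSpace ℝ E]
    {M : Type*} [TopologicalSpace M] [ChartedSpace E M] (x p : M) : E →L[ℝ] E :=
  mfderiv 𝓘(ℝ, E) 𝓘(ℝ, E) (extChartAt 𝓘(ℝ, E) x) p

/-- The differential at `y` of the inverse of the preferred chart at `x`. -/
def dChartSymm (x : M) (y : E) : E →L[ℝ] E :=
  mfderiv 𝓘(ℝ, E) 𝓘(ℝ, E) (extChartAt 𝓘(ℝ, E) x).symm y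

/-- The expression of a vector field in the preferred chart at `x`. -/
def vectorInChart (X : (x : M) → TangentSpace 𝓘(ℝ, E) x) (x : M) (y : E) : E :=
  dChart E x ((extChartAt 𝓘(ℝ, E) x).symm y) (X ((extChartAt 𝓘(ℝ, E) x).symm y))

/-- The vector field with constant value `v` in the preferred chart at `x`. -/
def coordField (x : M) (v : E) (p : M) : TangentSpace 𝓘(ℝ, E) p :=
  (mfderiv 𝓘(ℝ, E) 𝓘(ℝ, E) (extChartAt 𝓘(ℝ, E) x) p).inverse v

lemma target_mem_nhds (x : M) :
    ∀ᶠ y in 𝓝 (extChartAt 𝓘(ℝ, E) x x), y ∈ (extChartAt 𝓘(ℝ, E) x).target :=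
  extChartAt_target_mem_nhds x

lemma mvfderiv_eq_fderiv {f : M → ℝ} {x : M} (hf : ContMDiffAt 𝓘(ℝ, E) 𝓘(ℝ, ℝ) ∞ f x) (v : E) :
    mvfderiv 𝓘(ℝ, E) f x v =
      fderiv ℝ (fun y ↦ f ((extChartAt 𝓘(ℝ, E) x).symm y)) (extChartAt 𝓘(ℝ, E) x x) v := by
  have h : MDifferentiableAt 𝓘(ℝ, E) 𝓘(ℝ, ℝ) f x := hf.mdifferentiableAt (by simp)
  have : mfderiv 𝓘(ℝ, E) 𝓘(ℝ, ℝ) f x =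
      fderiv ℝ (fun y ↦ f ((extChartAt 𝓘(ℝ, E) x).symm y)) (extChartAt 𝓘(ℝ, E) x x) := by
    rw [h.mfderiv, show Set.range 𝓘(ℝ, E) = Set.univ from 𝓘(ℝ, E).range_eq_univ,
      fderivWithin_univ]
    rfl
  exact DFunLike.congr_fun this v

variable [IsManifold 𝓘(ℝ, E) ∞ M]

lemma dChart_dChartSymm {x : M} {y : E} (hy : y ∈ (extChartAt 𝓘(ℝ, E) x).target) (v : E) :
    dChart E x ((extChartAt 𝓘(ℝ, E) x).symm y) (dChartSymm x y v) = v := by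
  have h := mfderiv_extChartAt_comp_mfderivWithin_extChartAt_symm hy
  rw [show Set.range 𝓘(ℝ, E) = Set.univ from 𝓘(ℝ, E).range_eq_univ, mfderivWithin_univ] at h
  exact DFunLike.congr_fun h v

lemma dChartSymm_dChart {x : M} {y : E} (hy : y ∈ (extChartAt 𝓘(ℝ, E) x).target) (v : E) :
    dChartSymm x y (dChart E x ((extChartAt 𝓘(ℝ, E) x).symm y) v) = v := by
  have h := mfderivWithin_extChartAt_symm_comp_mfderiv_extChartAt hy
  rw [show Set.range 𝓘(ℝ, E) = Set.univ from 𝓘(ℝ, E).range_eq_univ, mfderivWithin_univ] at h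
  exact DFunLike.congr_fun h v

lemma dChart_self (x : M) (v : E) : dChart E x x v = v :=
  DFunLike.congr_fun (mfderiv_extChartAt_self (I := 𝓘(ℝ, E)) (x := x)) v

lemma dChartSymm_self (x : M) (v : E) : dChartSymm x (extChartAt 𝓘(ℝ, E) x x) v = v := by
  have h := mfderivWithin_range_extChartAt_symm (I := 𝓘(ℝ, E)) (x := x)
  rw [show Set.range 𝓘(ℝ, E) = Set.univ from 𝓘(ℝ, E).range_eq_univ, mfderivWithin_univ] at h
  exact DFunLike.congr_fun h v

lemma coordField_symm {x : M} {y : E} (hy : y ∈ (extChartAt 𝓘(ℝ, E) x).target) (v : E) :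
    coordField x v ((extChartAt 𝓘(ℝ, E) x).symm y) = dChartSymm x y v := by
  exact (isInvertible_mfderiv_extChartAt ((extChartAt 𝓘(ℝ, E) x).map_target hy)).inverse_apply_eq.2
    (dChart_dChartSymm hy v).symm

lemma vectorInChart_eq_mpullback (X : (x : M) → TangentSpace 𝓘(ℝ, E) x) {x : M} {y : E}
    (hy : y ∈ (extChartAt 𝓘(ℝ, E) x).target) :
    vectorInChart X x y =
      mpullbackWithin 𝓘(ℝ, E) 𝓘(ℝ, E) (extChartAt 𝓘(ℝ, E) x).symm X (Set.range 𝓘(ℝ, E)) y := by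
  have h := isInvertible_mfderivWithin_extChartAt_symm hy
  rw [show Set.range 𝓘(ℝ, E) = Set.univ from 𝓘(ℝ, E).range_eq_univ] at h ⊢
  refine (h.inverse_apply_eq.2 ?_).symm
  rw [mfderivWithin_univ]
  exact (dChartSymm_dChart hy _).symm

lemma dChartSymm_vectorInChart (X : (x : M) → TangentSpace 𝓘(ℝ, E) x) {x : M} {y : E}
    (hy : y ∈ (extChartAt 𝓘(ℝ, E) x).target) :
    dChartSymm x y (vectorInChart X x y) = X ((extChartAt 𝓘(ℝ, E) x).symm y) :=
  dChartSymm_dChart hy _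

lemma vectorInChart_coordField {x : M} {y : E} (hy : y ∈ (extChartAt 𝓘(ℝ, E) x).target) (v : E) :
    vectorInChart (coordField x v) x y = v := by
  unfold vectorInChart
  rw [coordField_symm hy, dChart_dChartSymm hy]

lemma vectorInChart_self (X : (x : M) → TangentSpace 𝓘(ℝ, E) x) (x : M) :
    vectorInChart X x (extChartAt 𝓘(ℝ, E) x x) = X x := by
  unfold vectorInChart
  rw [extChartAt_to_inv]
  exact dChart_self x _

/-- The manifold bracket is the chart bracket carried back by the differential of the chart, which
is the identity at the base point. -/
lemma mlieBracket_eq_lieBracket (X Y : (x : M) → TangentSpace 𝓘(ℝ, E) x) (x : M) :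
    mlieBracket 𝓘(ℝ, E) X Y x =
      lieBracket ℝ (vectorInChart X x) (vectorInChart Y x) (extChartAt 𝓘(ℝ, E) x x) := by
  have e : ∀ X : (x : M) → TangentSpace 𝓘(ℝ, E) x,
      vectorInChart X x =ᶠ[𝓝 (extChartAt 𝓘(ℝ, E) x x)]
      mpullbackWithin 𝓘(ℝ, E) 𝓘(ℝ, E) (extChartAt 𝓘(ℝ, E) x).symm X (Set.range 𝓘(ℝ, E)) :=
    fun X ↦ by
      filter_upwards [target_mem_nhds x] with y hy
      exact vectorInChart_eq_mpullback X hy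
  rw [(e X).lieBracket_vectorField_eq (e Y), ← mlieBracketWithin_univ, mlieBracketWithin_apply]
  refine ((isInvertible_mfderiv_extChartAt (mem_extChartAt_source x)).inverse_apply_eq).2 ?_
  refine Eq.trans ?_ (dChart_self (E := E) x _).symm
  rw [Set.preimage_univ, Set.univ_inter,
    show Set.range 𝓘(ℝ, E) = Set.univ from 𝓘(ℝ, E).range_eq_univ]
  exact congrFun (lieBracketWithin_univ (𝕜 := ℝ) (E := E)) _

variable [FiniteDimensional ℝ E]

lemma smoothNear_coordField (x : M) (v : E) : SmoothNear (coordField x v) x := by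
  have : CompleteSpace E := FiniteDimensional.complete ℝ E
  refine ContMDiffAt.mpullback_vectorField_preimage (V := fun _ : E ↦ v) (n := ∞) ?_
    (contMDiffAt_extChartAt) (isInvertible_mfderiv_extChartAt (mem_extChartAt_source x)) ?_
  · exact contMDiffAt_vectorSpace_iff_contDiffAt.2 contDiffAt_const
  · simp

lemma differentiableAt_vectorInChart {X : (x : M) → TangentSpace 𝓘(ℝ, E) x} {x : M}
    (hX : SmoothNear X x) : DifferentiableAt ℝ (vectorInChart X x) (extChartAt 𝓘(ℝ, E) x x) := by
  have : CompleteSpace E := FiniteDimensional.complete ℝ E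
  have h := contMDiffWithinAt_mpullbackWithin_extChartAt_symm (n := ∞)
    (contMDiffWithinAt_univ.2 hX) uniqueMDiffOn_univ (Set.mem_univ x) (by simp)
  rw [Set.preimage_univ, Set.inter_univ] at h
  have h' := contMDiffAt_vectorSpace_iff_contDiffAt.1
    (h.contMDiffAt (extChartAt_target_mem_nhds x))
  refine (h'.differentiableAt (by simp)).congr_of_eventuallyEq ?_
  filter_upwards [target_mem_nhds x] with y hy
  exact vectorInChart_eq_mpullback X hy

end Charts

/-! ### Metrics, endomorphism fields and the star condition in the preferred chart. -/

section Charts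

variable {E : Type*} [NormedAddCommGroup E] [NormedSpace ℝ E]
  {M : Type*} [TopologicalSpace M] [ChartedSpace E M]

/-- The value of an endomorphism field at a point, as an endomorphism of the model space. -/
def endAt (A : (x : M) → TangentSpace 𝓘(ℝ, E) x →L[ℝ] TangentSpace 𝓘(ℝ, E) x) (p : M) :
    E →L[ℝ] E := A p

lemma endInChart_apply (A : (x : M) → TangentSpace 𝓘(ℝ, E) x →L[ℝ] TangentSpace 𝓘(ℝ, E) x)
    (x : M) (y u : E) :
    endInChart A x y u = dChart E x ((extChartAt 𝓘(ℝ, E) x).symm y)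
      (endAt A ((extChartAt 𝓘(ℝ, E) x).symm y) (dChartSymm x y u)) := rfl

variable [IsManifold 𝓘(ℝ, E) ∞ M]

/-- The metric at a point, as a bilinear form on the model space. -/
def Metric.at (h : Metric E M) (p : M) : E →L[ℝ] E →L[ℝ] ℝ := h.val p

lemma Metric.inChart_apply (h : Metric E M) (x : M) (y u v : E) :
    h.inChart x y u v =
      h.at ((extChartAt 𝓘(ℝ, E) x).symm y) (dChartSymm x y u) (dChartSymm x y v) := rfl

lemma Metric.inChart_self (h : Metric E M) (x : M) (u v : E) :
    h.inChart x (extChartAt 𝓘(ℝ, E) x x) u v = h.at x u v := by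
  rw [h.inChart_apply, extChartAt_to_inv, dChartSymm_self, dChartSymm_self]

lemma endInChart_self (A : (x : M) → TangentSpace 𝓘(ℝ, E) x →L[ℝ] TangentSpace 𝓘(ℝ, E) x)
    (x : M) (u : E) : endInChart A x (extChartAt 𝓘(ℝ, E) x x) u = endAt A x u := by
  rw [endInChart_apply, extChartAt_to_inv, dChartSymm_self, dChart_self]

lemma Metric.inChart_symm (h : Metric E M) (x : M) (y u v : E) :
    h.inChart x y u v = h.inChart x y v u := by
  rw [h.inChart_apply, h.inChart_apply]
  exact h.symm _ _ _

lemma Metric.inChart_nondegenerate (h : Metric E M) (x : M) (v : E)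
    (hv : ∀ w, h.inChart x (extChartAt 𝓘(ℝ, E) x x) v w = 0) : v = 0 :=
  h.nondegenerate x v fun w ↦ (h.inChart_self x v w).symm.trans (hv w)

lemma Metric.inChart_vectorInChart (h : Metric E M) (X Y : (x : M) → TangentSpace 𝓘(ℝ, E) x)
    {x : M} {y : E} (hy : y ∈ (extChartAt 𝓘(ℝ, E) x).target) :
    h.inChart x y (vectorInChart X x y) (vectorInChart Y x y) =
      h.val ((extChartAt 𝓘(ℝ, E) x).symm y) (X _) (Y _) := by
  rw [h.inChart_apply, dChartSymm_vectorInChart X hy, dChartSymm_vectorInChart Y hy]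
  rfl

lemma endInChart_vectorInChart
    (A : (x : M) → TangentSpace 𝓘(ℝ, E) x →L[ℝ] TangentSpace 𝓘(ℝ, E) x)
    (X : (x : M) → TangentSpace 𝓘(ℝ, E) x) {x : M} {y : E}
    (hy : y ∈ (extChartAt 𝓘(ℝ, E) x).target) :
    vectorInChart (fun p ↦ A p (X p)) x y = endInChart A x y (vectorInChart X x y) := by
  rw [endInChart_apply, dChartSymm_vectorInChart X hy]
  rfl

lemma endInChart_golden {G : EndField E M} (hG : IsAlmostGolden G) {x : M} {y : E}
    (hy : y ∈ (extChartAt 𝓘(ℝ, E) x).target) (v : E) :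
    endInChart G.val x y (endInChart G.val x y v) = endInChart G.val x y v + v := by
  have h : endAt G.val ((extChartAt 𝓘(ℝ, E) x).symm y) (endAt G.val _ (dChartSymm x y v)) =
      endAt G.val _ (dChartSymm x y v) + dChartSymm x y v := hG _ _
  simp only [endInChart_apply, dChartSymm_dChart hy, h, map_add, dChart_dChartSymm hy]

lemma endInChart_pure {h : Metric E M} {G : EndField E M}
    (hG : ∀ (x : M) (u v : TangentSpace 𝓘(ℝ, E) x),
      h.val x (G.val x u) v = h.val x u (G.val x v)) {x : M} {y : E}
    (hy : y ∈ (extChartAt 𝓘(ℝ, E) x).target) (u v : E) :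
    h.inChart x y (endInChart G.val x y u) v = h.inChart x y u (endInChart G.val x y v) := by
  simp only [endInChart_apply, h.inChart_apply, dChartSymm_dChart hy]
  exact hG _ _ _

lemma SmoothNear.endField {X : (x : M) → TangentSpace 𝓘(ℝ, E) x} {x : M} (hX : SmoothNear X x)
    (A : EndField E M) : SmoothNear (fun p ↦ A.val p (X p)) x :=
  ContMDiffAt.clm_bundle_apply (A.contMDiff x) hX

lemma SmoothNear.contMDiffAt_metric {X Y : (x : M) → TangentSpace 𝓘(ℝ, E) x} {x : M}
    (hX : SmoothNear X x) (hY : SmoothNear Y x) (h : Metric E M) :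
    ContMDiffAt 𝓘(ℝ, E) 𝓘(ℝ, ℝ) ∞ (fun p ↦ h.val p (X p) (Y p)) x := by
  have key : ContMDiffAt 𝓘(ℝ, E) (𝓘(ℝ, E).prod 𝓘(ℝ, ℝ)) ∞
      (fun p ↦ Bundle.TotalSpace.mk' ℝ (E := Bundle.Trivial M ℝ) p (h.val p (X p) (Y p))) x :=
    ContMDiffAt.clm_bundle_apply₂ (F₁ := E) (F₂ := E) (h.contMDiff x) hX hY
  exact (Bundle.contMDiffAt_section x).1 key

lemma tachibana_eq_localTachibana (h : Metric E M) (A : EndField E M)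
    {X Y Z : (x : M) → TangentSpace 𝓘(ℝ, E) x} {x : M}
    (hY : SmoothNear Y x) (hZ : SmoothNear Z x) :
    tachibana h A.val X Y Z x = localTachibana (h.inChart x) (endInChart A.val x)
      (vectorInChart X x) (vectorInChart Y x) (vectorInChart Z x) (extChartAt 𝓘(ℝ, E) x x) := by
  have eA : ∀ X : (x : M) → TangentSpace 𝓘(ℝ, E) x,
      vectorInChart (fun p ↦ A.val p (X p)) x =ᶠ[𝓝 (extChartAt 𝓘(ℝ, E) x x)]
        fun y ↦ endInChart A.val x y (vectorInChart X x y) := fun X ↦ by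
    filter_upwards [target_mem_nhds x] with y hy
    exact endInChart_vectorInChart _ _ hy
  have d : ∀ X Y : (x : M) → TangentSpace 𝓘(ℝ, E) x, SmoothNear X x → SmoothNear Y x → ∀ v : E,
      mvfderiv 𝓘(ℝ, E) (fun p ↦ h.val p (X p) (Y p)) x v =
        fderiv ℝ (fun y ↦ h.inChart x y (vectorInChart X x y) (vectorInChart Y x y))
          (extChartAt 𝓘(ℝ, E) x x) v := fun X Y hX hY v ↦ by
    rw [mvfderiv_eq_fderiv (hX.contMDiffAt_metric hY h) v]
    congr 1
    refine Filter.EventuallyEq.fderiv_eq ?_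
    filter_upwards [target_mem_nhds x] with y hy
    exact (h.inChart_vectorInChart X Y hy).symm
  have l : ∀ Y X : (x : M) → TangentSpace 𝓘(ℝ, E) x, lieDerivEnd A.val Y X x =
      lieBracket ℝ (vectorInChart Y x) (fun z ↦ endInChart A.val x z (vectorInChart X x z))
          (extChartAt 𝓘(ℝ, E) x x)
        - endInChart A.val x (extChartAt 𝓘(ℝ, E) x x)
          (lieBracket ℝ (vectorInChart Y x) (vectorInChart X x) (extChartAt 𝓘(ℝ, E) x x)) :=
    fun Y X ↦ by
    unfold lieDerivEnd
    rw [mlieBracket_eq_lieBracket, mlieBracket_eq_lieBracket,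
      EventuallyEq.lieBracket_vectorField_eq EventuallyEq.rfl (eA X), endInChart_self]
    rfl
  have e2 : fderiv ℝ (fun y ↦ h.inChart x y (vectorInChart (fun p ↦ A.val p (Y p)) x y)
        (vectorInChart Z x y)) (extChartAt 𝓘(ℝ, E) x x) =
      fderiv ℝ (fun y ↦ h.inChart x y (endInChart A.val x y (vectorInChart Y x y))
        (vectorInChart Z x y)) (extChartAt 𝓘(ℝ, E) x x) := by
    refine Filter.EventuallyEq.fderiv_eq ?_
    filter_upwards [eA Y] with y hy
    rw [hy]
  unfold tachibana localTachibana
  rw [h.inChart_self, h.inChart_self, endInChart_self, vectorInChart_self, vectorInChart_self,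
    vectorInChart_self, ← e2]
  rw [← l, ← l]
  exact congrArg₂ (· + ·) (congrArg₂ (· + ·) (congrArg₂ (· - ·) (d Y Z hY hZ _)
    (d _ Z (hY.endField A) hZ _)) rfl) rfl

variable [FiniteDimensional ℝ E]

/-- The components are the smooth functions obtained by evaluating `h` on coordinate fields. -/
lemma Metric.differentiableAt_inChart (h : Metric E M) (x : M) :
    DifferentiableAt ℝ (h.inChart x) (extChartAt 𝓘(ℝ, E) x x) := by
  refine differentiableAt_of_apply fun u ↦ differentiableAt_of_apply fun v ↦ ?_
  have h1 := (smoothNear_coordField x u).contMDiffAt_metric (smoothNear_coordField x v) h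
  have h2 := (contMDiffAt_iff.1 h1).2
  rw [show Set.range 𝓘(ℝ, E) = Set.univ from 𝓘(ℝ, E).range_eq_univ, contDiffWithinAt_univ] at h2
  refine (h2.differentiableAt (by simp)).congr_of_eventuallyEq ?_
  filter_upwards [target_mem_nhds x] with y hy
  rw [← vectorInChart_coordField hy u, ← vectorInChart_coordField hy v]
  have := h.inChart_vectorInChart (coordField x u) (coordField x v) hy
  rw [vectorInChart_coordField hy u, vectorInChart_coordField hy v] at this ⊢
  exact this

lemma differentiableAt_endInChart (A : EndField E M) (x : M) :
    DifferentiableAt ℝ (endInChart A.val x) (extChartAt 𝓘(ℝ, E) x x) := by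
  refine differentiableAt_of_apply fun u ↦ ?_
  refine (differentiableAt_vectorInChart
    ((smoothNear_coordField x u).endField A)).congr_of_eventuallyEq ?_
  filter_upwards [target_mem_nhds x] with y hy
  rw [endInChart_vectorInChart _ _ hy, vectorInChart_coordField hy]

/-- If the metric is pure with respect to `A`, then `Ψ(X, Y, Z) = 2 h((∇_Y A) X, Z)`. -/
lemma psi_eq (h : Metric E M) (A : EndField E M)
    (hp : ∀ (x : M) (u v : TangentSpace 𝓘(ℝ, E) x),
      h.val x (A.val x u) v = h.val x u (A.val x v))
    {X Y Z : (x : M) → TangentSpace 𝓘(ℝ, E) x} {x : M}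
    (hX : SmoothNear X x) (hY : SmoothNear Y x) (hZ : SmoothNear Z x) :
    psi h A.val X Y Z x = 2 * h.inChart x (extChartAt 𝓘(ℝ, E) x x)
      (localNablaEnd (h.inChart x) (endInChart A.val x) (extChartAt 𝓘(ℝ, E) x x)
        (vectorInChart Y x (extChartAt 𝓘(ℝ, E) x x)) (vectorInChart X x (extChartAt 𝓘(ℝ, E) x x)))
      (vectorInChart Z x (extChartAt 𝓘(ℝ, E) x x)) := by
  have hH := h.differentiableAt_inChart x
  have hA := differentiableAt_endInChart A x
  have hs : ∀ᶠ z in 𝓝 (extChartAt 𝓘(ℝ, E) x x), ∀ u v, h.inChart x z u v = h.inChart x z v u :=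
    Eventually.of_forall (h.inChart_symm x)
  have hb := h.inChart_nondegenerate x
  have hp' : ∀ᶠ z in 𝓝 (extChartAt 𝓘(ℝ, E) x x), ∀ u v,
      h.inChart x z (endInChart A.val x z u) v = h.inChart x z u (endInChart A.val x z v) := by
    filter_upwards [target_mem_nhds x] with y hy
    exact endInChart_pure hp hy
  have dX := differentiableAt_vectorInChart hX
  have dY := differentiableAt_vectorInChart hY
  have dZ := differentiableAt_vectorInChart hZ
  unfold psi
  rw [tachibana_eq_localTachibana h A hY hZ, tachibana_eq_localTachibana h A hY hX,
    localTachibana_eq hH hA hs hb hp' dX dY dZ, localTachibana_eq hH hA hs hb hp' dZ dY dX]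
  -- Since `∇A` is self-adjoint, the terms differentiating along `X` and along `Z` cancel between
  -- the two Tachibana expressions, while those along `Y` coincide.
  have hsw := fun u v w ↦ (localNablaEnd_pure hH hA hs hb hp' u v w).trans (h.inChart_symm x _ _ _)
  rw [hsw _ (vectorInChart Z x _) (vectorInChart Y x _),
    hsw _ (vectorInChart Z x _) (vectorInChart X x _),
    hsw _ (vectorInChart X x _) (vectorInChart Y x _)]
  ring

/-- The condition `A(∗)` forces `∇ A = 0` on an almost golden Riemannian manifold. -/
lemma localNablaEnd_eq_zero_of_starCondition (h : Metric E M) (A : EndField E M)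
    (hA : IsAlmostGolden A)
    (hp : ∀ (x : M) (u v : TangentSpace 𝓘(ℝ, E) x),
      h.val x (A.val x u) v = h.val x u (A.val x v))
    (hS : StarCondition h A.val) (x : M) (u v : E) :
    localNablaEnd (h.inChart x) (endInChart A.val x) (extChartAt 𝓘(ℝ, E) x x) u v = 0 := by
  have hx := mem_extChartAt_target (I := 𝓘(ℝ, E)) x
  refine star_eq_zero
    (localNablaEndₗ (h.inChart x) (endInChart A.val x) (extChartAt 𝓘(ℝ, E) x x))
    (endInChart A.val x (extChartAt 𝓘(ℝ, E) x x)).toLinearMap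
    (fun v ↦ endInChart_golden hA hx v) (fun u v ↦ ?_) u v
  rw [← sub_eq_zero]
  -- Coordinate fields realise arbitrary vectors at `x`, so the star condition on fields yields the
  -- pointwise relation required by `star_eq_zero`.
  refine h.inChart_nondegenerate x _ fun w ↦ ?_
  have su := smoothNear_coordField x u
  have sv := smoothNear_coordField x v
  have sw := smoothNear_coordField x w
  have key := hS x (coordField x u) (coordField x v) (coordField x w) su sv sw
  rw [psi_eq h A hp su sv sw, psi_eq h A hp sv su sw,
    psi_eq h A hp (sv.endField A) (su.endField A) sw,
    endInChart_vectorInChart A.val (coordField x u) hx,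
    endInChart_vectorInChart A.val (coordField x v) hx,
    vectorInChart_coordField hx u, vectorInChart_coordField hx v,
    vectorInChart_coordField hx w] at key
  simp only [localNablaEndₗ, LinearMap.mk₂_apply, ContinuousLinearMap.coe_coe, map_sub, map_add,
    sub_apply, add_apply]
  linarith

end Charts

/-! ### The product structure associated with a golden structure. -/

section TwinProduct

variable {E : Type*} [NormedAddCommGroup E] [NormedSpace ℝ E]

/-- The product structure `(1 / √5) (2 A - I)` of an endomorphism `A`. -/
def twin (A : E →L[ℝ] E) : E →L[ℝ] E :=
  (1 / √5 : ℝ) • ((2 : ℝ) • A - ContinuousLinearMap.id ℝ E)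

lemma twin_apply (A : E →L[ℝ] E) (v : E) : twin A v = (1 / √5 : ℝ) • ((2 : ℝ) • A v - v) := rfl

/-- `(2A - I)² = 4(A² - A) + I = 5I`, which explains the factor `1/√5`. -/
lemma twin_twin {A : E →L[ℝ] E} (hA : ∀ v, A (A v) = A v + v) (v : E) : twin A (twin A v) = v := by
  have h5 : (1 / √5 : ℝ) * (1 / √5) = 1 / 5 := by
    rw [div_mul_div_comm, one_mul, Real.mul_self_sqrt (by norm_num)]
  simp only [twin_apply, map_smul, map_sub, hA]
  rw [← smul_comm (1 / √5 : ℝ) (2 : ℝ), ← smul_sub, smul_smul, h5]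
  module

lemma hasFDerivAt_twin {A : E → E →L[ℝ] E} {y : E} (hA : DifferentiableAt ℝ A y) :
    HasFDerivAt (fun z ↦ twin (A z)) ((2 / √5 : ℝ) • fderiv ℝ A y) y := by
  have h : HasFDerivAt (fun z ↦ twin (A z)) ((1 / √5 : ℝ) • ((2 : ℝ) • fderiv ℝ A y)) y :=
    ((hA.hasFDerivAt.fun_const_smul (2 : ℝ)).sub_const
      (ContinuousLinearMap.id ℝ E)).fun_const_smul (1 / √5 : ℝ)
  refine h.congr_fderiv ?_
  rw [smul_smul]
  congr 1
  ring

lemma localNablaEnd_twin {H : E → E →L[ℝ] E →L[ℝ] ℝ} {A : E → E →L[ℝ] E} {y : E}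
    (hA : DifferentiableAt ℝ A y) (u v : E) :
    localNablaEnd H (fun z ↦ twin (A z)) y u v = (2 / √5 : ℝ) • localNablaEnd H A y u v := by
  unfold localNablaEnd
  simp only [(hasFDerivAt_twin hA).fderiv, twin_apply, christoffel_smul_right, smul_apply,
    sub_eq_add_neg, christoffel_add_right]
  rw [← neg_one_smul ℝ v, christoffel_smul_right]
  module

lemma localNablaEnd_neg (H : E → E →L[ℝ] E →L[ℝ] ℝ) (A : E → E →L[ℝ] E) (y u v : E) :
    localNablaEnd H (fun z ↦ - A z) y u v = - localNablaEnd H A y u v := by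
  unfold localNablaEnd
  rw [fderiv_fun_neg]
  simp only [neg_apply]
  rw [← neg_one_smul ℝ (A y v), christoffel_smul_right]
  module

lemma localNablaEnd_congr {H : E → E →L[ℝ] E →L[ℝ] ℝ} {A B : E → E →L[ℝ] E} {y : E}
    (h : A =ᶠ[𝓝 y] B) (u v : E) : localNablaEnd H A y u v = localNablaEnd H B y u v := by
  unfold localNablaEnd
  rw [h.fderiv_eq, h.eq_of_nhds]

/-- Differentiating `P² = I`. -/
lemma localNablaEnd_involutive {H : E → E →L[ℝ] E →L[ℝ] ℝ} {P : E → E →L[ℝ] E} {y : E}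
    (hP : DifferentiableAt ℝ P y) (hPP : ∀ᶠ z in 𝓝 y, ∀ v, P z (P z v) = v) (u v : E) :
    localNablaEnd H P y u (P y v) = - P y (localNablaEnd H P y u v) := by
  have hPv : DifferentiableAt ℝ (fun z ↦ P z v) y := hP.clm_apply (differentiableAt_const v)
  have e : (fun z ↦ P z (P z v)) =ᶠ[𝓝 y] fun _ ↦ v := hPP.mono fun z hz ↦ hz v
  have key := DFunLike.congr_fun (e.fderiv_eq (𝕜 := ℝ)) u
  rw [fderiv_end_apply hP hPv, fderiv_end_apply hP (differentiableAt_const v)] at key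
  simp only [fderiv_fun_const, Pi.zero_apply, zero_apply, map_zero, add_zero] at key
  simp only [localNablaEnd, map_add, map_sub, hPP.self_of_nhds]
  rw [eq_neg_of_add_eq_zero_left key]
  abel

end TwinProduct

/-! ### Differentials and intertwining relations in charts. -/

section Maps

variable {E : Type*} [NormedAddCommGroup E] [NormedSpace ℝ E]
  {M : Type*} [TopologicalSpace M] [ChartedSpace E M]
  {E' : Type*} [NormedAddCommGroup E'] [NormedSpace ℝ E']
  {N : Type*} [TopologicalSpace N] [ChartedSpace E' N]

lemma writtenInExtChartAt_self (F : M → N) (x : M) :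
    writtenInExtChartAt 𝓘(ℝ, E) 𝓘(ℝ, E') x F (extChartAt 𝓘(ℝ, E) x x) =
      extChartAt 𝓘(ℝ, E') (F x) (F x) := by
  simp [writtenInExtChartAt]

lemma contDiffAt_writtenInExtChartAt {F : M → N} (hF : ContMDiff 𝓘(ℝ, E) 𝓘(ℝ, E') ∞ F) (x : M) :
    ContDiffAt ℝ ∞ (writtenInExtChartAt 𝓘(ℝ, E) 𝓘(ℝ, E') x F) (extChartAt 𝓘(ℝ, E) x x) := by
  have h := (contMDiffAt_iff.1 (hF x)).2
  rwa [show Set.range 𝓘(ℝ, E) = Set.univ from 𝓘(ℝ, E).range_eq_univ, contDiffWithinAt_univ] at h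

/-- The differential of a map at a point, between the model spaces. -/
def dMap (E E' : Type*) [NormedAddCommGroup E] [NormedSpace ℝ E]
    [NormedAddCommGroup E'] [NormedSpace ℝ E']
    {M : Type*} [TopologicalSpace M] [ChartedSpace E M]
    {N : Type*} [TopologicalSpace N] [ChartedSpace E' N] (F : M → N) (p : M) : E →L[ℝ] E' :=
  mfderiv 𝓘(ℝ, E) 𝓘(ℝ, E') F p

lemma eventually_mem_source {F : M → N} (hF : ContMDiff 𝓘(ℝ, E) 𝓘(ℝ, E') ∞ F) (x : M) :
    ∀ᶠ y in 𝓝 (extChartAt 𝓘(ℝ, E) x x),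
      F ((extChartAt 𝓘(ℝ, E) x).symm y) ∈ (extChartAt 𝓘(ℝ, E') (F x)).source := by
  have h1 : ContinuousAt (fun y ↦ F ((extChartAt 𝓘(ℝ, E) x).symm y)) (extChartAt 𝓘(ℝ, E) x x) :=
    (hF.continuous.continuousAt).comp (continuousAt_extChartAt_symm x)
  refine h1.eventually_mem ?_
  rw [extChartAt_to_inv]
  exact extChartAt_source_mem_nhds (F x)

variable [IsManifold 𝓘(ℝ, E) ∞ M] [IsManifold 𝓘(ℝ, E') ∞ N]

lemma endInChart_twinProduct [FiniteDimensional ℝ E] (G : EndField E M) {x : M} {y : E}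
    (hy : y ∈ (extChartAt 𝓘(ℝ, E) x).target) :
    endInChart (twinProduct G) x y = twin (endInChart G.val x y) := by
  ext v
  have : endAt (twinProduct G) ((extChartAt 𝓘(ℝ, E) x).symm y) (dChartSymm x y v) =
    (1 / √5 : ℝ) • ((2 : ℝ) • endAt G.val ((extChartAt 𝓘(ℝ, E) x).symm y) (dChartSymm x y v)
      - dChartSymm x y v) := rfl
  rw [twin_apply, endInChart_apply, endInChart_apply, this]
  simp only [map_smul, map_sub, dChart_dChartSymm hy]

lemma fderiv_writtenInExtChartAt {F : M → N} (hF : ContMDiff 𝓘(ℝ, E) 𝓘(ℝ, E') ∞ F) {x : M} {y : E}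
    (hy : y ∈ (extChartAt 𝓘(ℝ, E) x).target)
    (hFy : F ((extChartAt 𝓘(ℝ, E) x).symm y) ∈ (extChartAt 𝓘(ℝ, E') (F x)).source) (v : E) :
    fderiv ℝ (writtenInExtChartAt 𝓘(ℝ, E) 𝓘(ℝ, E') x F) y v =
      dChart E' (F x) (F ((extChartAt 𝓘(ℝ, E) x).symm y))
        (dMap E E' F ((extChartAt 𝓘(ℝ, E) x).symm y) (dChartSymm x y v)) := by
  have d1 : MDifferentiableAt 𝓘(ℝ, E) 𝓘(ℝ, E) (extChartAt 𝓘(ℝ, E) x).symm y := by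
    have := mdifferentiableWithinAt_extChartAt_symm hy
    rwa [show Set.range 𝓘(ℝ, E) = Set.univ from 𝓘(ℝ, E).range_eq_univ,
      mdifferentiableWithinAt_univ] at this
  have d2 : MDifferentiableAt 𝓘(ℝ, E) 𝓘(ℝ, E') F ((extChartAt 𝓘(ℝ, E) x).symm y) :=
    (hF _).mdifferentiableAt (by simp)
  have d3 : MDifferentiableAt 𝓘(ℝ, E') 𝓘(ℝ, E') (extChartAt 𝓘(ℝ, E') (F x))
      (F ((extChartAt 𝓘(ℝ, E) x).symm y)) :=
    mdifferentiableAt_extChartAt (by rwa [← extChartAt_source 𝓘(ℝ, E')])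
  have c := mfderiv_comp y d3 (d2.comp y d1)
  rw [mfderiv_comp y d2 d1] at c
  have e : mfderiv 𝓘(ℝ, E) 𝓘(ℝ, E') (writtenInExtChartAt 𝓘(ℝ, E) 𝓘(ℝ, E') x F) y =
    fderiv ℝ (writtenInExtChartAt 𝓘(ℝ, E) 𝓘(ℝ, E') x F) y := mfderiv_eq_fderiv
  rw [← e]
  exact DFunLike.congr_fun c v

/-- The coefficients `(a, b)` cover golden maps, `(0, 1)`, and antigolden maps, `(1, -1)`, at once.
The relation is kept on a neighbourhood because it is to be differentiated. -/
lemma intertwine_inChart {F : M → N} (hF : ContMDiff 𝓘(ℝ, E) 𝓘(ℝ, E') ∞ F)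
    (A : (x : M) → TangentSpace 𝓘(ℝ, E) x →L[ℝ] TangentSpace 𝓘(ℝ, E) x)
    (B : (x : N) → TangentSpace 𝓘(ℝ, E') x →L[ℝ] TangentSpace 𝓘(ℝ, E') x) {a b : ℝ}
    (hAB : ∀ (p : M) (v : E), dMap E E' F p (endAt A p v) =
      a • dMap E E' F p v + b • endAt B (F p) (dMap E E' F p v)) (x : M) :
    ∀ᶠ y in 𝓝 (extChartAt 𝓘(ℝ, E) x x), ∀ v,
      fderiv ℝ (writtenInExtChartAt 𝓘(ℝ, E) 𝓘(ℝ, E') x F) y (endInChart A x y v) =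
        a • fderiv ℝ (writtenInExtChartAt 𝓘(ℝ, E) 𝓘(ℝ, E') x F) y v +
        b • endInChart B (F x) (writtenInExtChartAt 𝓘(ℝ, E) 𝓘(ℝ, E') x F y)
          (fderiv ℝ (writtenInExtChartAt 𝓘(ℝ, E) 𝓘(ℝ, E') x F) y v) := by
  filter_upwards [target_mem_nhds x, eventually_mem_source hF x] with y hy hFy v
  rw [fderiv_writtenInExtChartAt hF hy hFy, fderiv_writtenInExtChartAt hF hy hFy,
    endInChart_apply, dChartSymm_dChart hy, hAB, map_add, map_smul, map_smul]
  have w : writtenInExtChartAt 𝓘(ℝ, E) 𝓘(ℝ, E') x F y =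
    extChartAt 𝓘(ℝ, E') (F x) (F ((extChartAt 𝓘(ℝ, E) x).symm y)) := rfl
  have l := (extChartAt 𝓘(ℝ, E') (F x)).left_inv hFy
  have t := (extChartAt 𝓘(ℝ, E') (F x)).map_source hFy
  have := fun z ↦ dChartSymm_dChart t z
  rw [l] at this
  rw [w, endInChart_apply, l, this]

end Maps

/-! ### Vanishing of the tension field. -/

section Harmonic

variable {E : Type*} [NormedAddCommGroup E] [NormedSpace ℝ E] [FiniteDimensional ℝ E]
  {M : Type*} [TopologicalSpace M] [ChartedSpace E M] [IsManifold 𝓘(ℝ, E) ∞ M]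
  {E' : Type*} [NormedAddCommGroup E'] [NormedSpace ℝ E'] [FiniteDimensional ℝ E']
  {N : Type*} [TopologicalSpace N] [ChartedSpace E' N] [IsManifold 𝓘(ℝ, E') ∞ N]

/-- The operator `S` of the product structure of `K` vanishes, in a chart. -/
lemma sOperator_inChart_eq_zero {g : Metric E' N} {K : EndField E' N}
    (hN : IsQuasiGoldenKaehler g K ∨ IsLocallyDecomposableGoldenRiemannian g K) (q : N) (u v : E') :
    localNablaEnd (g.inChart q) (fun z ↦ twin (endInChart K.val q z)) (extChartAt 𝓘(ℝ, E') q q) u v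
      + twin (endInChart K.val q (extChartAt 𝓘(ℝ, E') q q))
        (localNablaEnd (g.inChart q) (fun z ↦ twin (endInChart K.val q z))
          (extChartAt 𝓘(ℝ, E') q q)
          (twin (endInChart K.val q (extChartAt 𝓘(ℝ, E') q q)) u) v) = 0 := by
  rcases hN with hN | hN
  · have e : (fun z ↦ twin (endInChart K.val q z)) =ᶠ[𝓝 (extChartAt 𝓘(ℝ, E') q q)]
        endInChart (twinProduct K) q := by
      filter_upwards [target_mem_nhds q] with y hy
      exact (endInChart_twinProduct K hy).symm
    have e0 : twin (endInChart K.val q (extChartAt 𝓘(ℝ, E') q q)) =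
      endInChart (twinProduct K) q (extChartAt 𝓘(ℝ, E') q q) := e.eq_of_nhds
    rw [localNablaEnd_congr e, localNablaEnd_congr e, e0, endInChart_self, endInChart_self]
    exact hN.2 q u v
  · have h0 := localNablaEnd_eq_zero_of_starCondition g K hN.1.1 hN.1.2.2 hN.2.2 q
    have hd := differentiableAt_endInChart K q
    rw [localNablaEnd_twin hd, localNablaEnd_twin hd, h0, h0]
    simp

lemma tensionField_eq_zero {h : Metric E M} {G : EndField E M} {g : Metric E' N} {F : M → N}
    (hF : ContMDiff 𝓘(ℝ, E) 𝓘(ℝ, E') ∞ F) (hM : IsSemiGoldenKaehler h G) (x : M)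
    (Q : E' → E' →L[ℝ] E')
    (hQ : DifferentiableAt ℝ Q (extChartAt 𝓘(ℝ, E') (F x) (F x)))
    (hQQ : ∀ v, Q (extChartAt 𝓘(ℝ, E') (F x) (F x)) (Q (extChartAt 𝓘(ℝ, E') (F x) (F x)) v) = v)
    (hS : ∀ u v, localNablaEnd (g.inChart (F x)) Q (extChartAt 𝓘(ℝ, E') (F x) (F x)) u v +
      Q (extChartAt 𝓘(ℝ, E') (F x) (F x)) (localNablaEnd (g.inChart (F x)) Q
        (extChartAt 𝓘(ℝ, E') (F x) (F x)) (Q (extChartAt 𝓘(ℝ, E') (F x) (F x)) u) v) = 0)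
    (hPQ : ∀ᶠ y in 𝓝 (extChartAt 𝓘(ℝ, E) x x), ∀ v,
      fderiv ℝ (writtenInExtChartAt 𝓘(ℝ, E) 𝓘(ℝ, E') x F) y (twin (endInChart G.val x y) v) =
        Q (writtenInExtChartAt 𝓘(ℝ, E) 𝓘(ℝ, E') x F y)
          (fderiv ℝ (writtenInExtChartAt 𝓘(ℝ, E) 𝓘(ℝ, E') x F) y v)) :
    tensionField h g F x = 0 := by
  set f := writtenInExtChartAt 𝓘(ℝ, E) 𝓘(ℝ, E') x F with hf
  set y := extChartAt 𝓘(ℝ, E) x x with hy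
  have hyt : y ∈ (extChartAt 𝓘(ℝ, E) x).target := mem_extChartAt_target x
  rw [← show f y = extChartAt 𝓘(ℝ, E') (F x) (F x) from writtenInExtChartAt_self F x]
    at hQ hQQ hS
  have hg : DifferentiableAt ℝ (g.inChart (F x)) (f y) := by
    rw [show f y = extChartAt 𝓘(ℝ, E') (F x) (F x) from writtenInExtChartAt_self F x]
    exact g.differentiableAt_inChart (F x)
  have hf' : ContDiffAt ℝ ∞ f y := contDiffAt_writtenInExtChartAt hF x
  have hG := differentiableAt_endInChart G x
  have hP := (hasFDerivAt_twin hG).differentiableAt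
  have hPP : ∀ᶠ z in 𝓝 y, ∀ v,
      twin (endInChart G.val x z) (twin (endInChart G.val x z) v) = v := by
    filter_upwards [target_mem_nhds x] with z hz
    exact twin_twin (endInChart_golden hM.1.1 hz)
  let D : E →ₗ[ℝ] E' := (fderiv ℝ f y).toLinearMap
  -- The same basis as in `metricTrace`, so the goal and `div G = 0` become Gram sums by unfolding.
  let e : Module.Basis (Fin (Module.finrank ℝ E)) ℝ E := Module.finBasis ℝ E
  let b : E →ₗ[ℝ] E →ₗ[ℝ] ℝ := LinearMap.mk₂ ℝ (fun u v ↦ h.at x u v)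
    (fun _ _ _ ↦ by simp) (fun _ _ _ ↦ by simp) (fun _ _ _ ↦ by simp) (fun _ _ _ ↦ by simp)
  refine sum_gram_inv_eq_zero e b (fun u v ↦ h.symm x u v) (fun v hv ↦ h.nondegenerate x v hv)
    (twin (endInChart G.val x y)).toLinearMap (fun u v ↦ ?_) hPP.self_of_nhds
    (Q (f y)).toLinearMap hQQ D
    (localSecondFundamentalFormₗ (h.inChart x) (g.inChart (F x)) f y)
    (localNablaEndₗ (h.inChart x) (fun z ↦ twin (endInChart G.val x z)) y)
    ((localNablaEndₗ (g.inChart (F x)) Q (f y)).compl₁₂ D D)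
    (fun u v ↦ localSecondFundamentalForm_symm (h.differentiableAt_inChart x)
      (Eventually.of_forall (h.inChart_symm x)) hg
      (Eventually.of_forall (g.inChart_symm (F x))) hf' u v)
    (localNablaEnd_involutive hP hPP)
    (localSecondFundamentalForm_intertwine hP hQ hf' hPQ)
    (fun u v ↦ ?_) ?_
  · have key : h.at x (endAt G.val x u) v = h.at x u (v - endAt G.val x v) := hM.1.2 x u v
    change h.at x (twin (endInChart G.val x y) u) v = - h.at x u (twin (endInChart G.val x y) v)
    rw [twin_apply, twin_apply, endInChart_self, endInChart_self]
    simp only [map_smul, map_sub, smul_apply, sub_apply, smul_eq_mul, key]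
    ring
  · have := hS (D u) (D v)
    rw [show Q (f y) (D u) = D (twin (endInChart G.val x y) u) from
      (hPQ.self_of_nhds u).symm] at this
    exact this
  · have key : ∑ i, ∑ j, (Matrix.of fun i j ↦ b (e i) (e j))⁻¹ i j •
        localNablaEnd (h.inChart x) (endInChart G.val x) y (e i) (e j) = 0 := hM.2 x
    simp only [localNablaEndₗ, LinearMap.mk₂_apply, hy, localNablaEnd_twin hG]
    simp only [smul_comm _ (2 / √5 : ℝ), ← Finset.smul_sum]
    rw [key, smul_zero]

end Harmonic

end GoldenGeometry

end

theorem mainTheorem6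
    {E : Type*} [NormedAddCommGroup E] [NormedSpace ℝ E] [FiniteDimensional ℝ E]
    {M : Type*} [TopologicalSpace M] [ChartedSpace E M] [IsManifold 𝓘(ℝ, E) ∞ M]
    {E' : Type*} [NormedAddCommGroup E'] [NormedSpace ℝ E'] [FiniteDimensional ℝ E']
    {N : Type*} [TopologicalSpace N] [ChartedSpace E' N] [IsManifold 𝓘(ℝ, E') ∞ N]
    (h : GoldenGeometry.Metric E M) (G : GoldenGeometry.EndField E M)
    (g : GoldenGeometry.Metric E' N) (K : GoldenGeometry.EndField E' N)
    (F : M → N)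
    (hF : GoldenGeometry.IsGoldenMap G K F ∨ GoldenGeometry.IsAntigoldenMap G K F)
    (hM : GoldenGeometry.IsSemiGoldenKaehler h G)
    (hN : GoldenGeometry.IsQuasiGoldenKaehler g K ∨
      GoldenGeometry.IsLocallyDecomposableGoldenRiemannian g K) :
    GoldenGeometry.IsHarmonic h g F := by
  open GoldenGeometry in
  have hK : IsAlmostGolden K := hN.elim (fun h ↦ h.1.1) (fun h ↦ h.1.1)
  have hQQ := fun x ↦ twin_twin (endInChart_golden hK (mem_extChartAt_target (I := 𝓘(ℝ, E')) (F x)))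
  rcases hF with hF | hF
  · refine ⟨hF.1, fun x ↦ tensionField_eq_zero hF.1 hM x
      (fun z ↦ twin (endInChart K.val (F x) z))
      (hasFDerivAt_twin (differentiableAt_endInChart K (F x))).differentiableAt (hQQ x)
      (sOperator_inChart_eq_zero hN (F x)) ?_⟩
    have := intertwine_inChart hF.1 G.val K.val (a := 0) (b := 1)
      (fun p v ↦ by rw [zero_smul, one_smul, zero_add]; exact hF.2 p v) x
    filter_upwards [this] with y hy v
    simp only [twin_apply, map_smul, map_sub, hy]
    module
  · refine ⟨hF.1, fun x ↦ tensionField_eq_zero hF.1 hM x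
      -- Passing from `K` to `I - K` changes the sign of the product structure.
      (fun z ↦ - twin (endInChart K.val (F x) z))
      (hasFDerivAt_twin (differentiableAt_endInChart K (F x))).differentiableAt.neg
      (fun v ↦ by rw [neg_apply, neg_apply, map_neg, neg_neg, hQQ x]) (fun u v ↦ ?_) ?_⟩
    -- `S` is odd, `S_{-R} = -S_R`: its second term is cubic in the sign, its first linear.
    · rw [localNablaEnd_neg, localNablaEnd_neg]
      have hneg := fun w ↦ (localNablaEndₗ (g.inChart (F x))
        (fun z ↦ twin (endInChart K.val (F x) z)) (extChartAt 𝓘(ℝ, E') (F x) (F x))).map_neg₂ w v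
      simp only [localNablaEndₗ, LinearMap.mk₂_apply] at hneg
      rw [neg_apply, neg_apply, hneg, neg_neg, ← neg_add, sOperator_inChart_eq_zero hN, neg_zero]
    · have := intertwine_inChart hF.1 G.val K.val (a := 1) (b := -1)
        (fun p v ↦ by rw [one_smul, neg_one_smul, ← sub_eq_add_neg]; exact hF.2 p v) x
      filter_upwards [this] with y hy v
      simp only [twin_apply, map_smul, map_sub, hy, neg_apply]
      module
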